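/- Let $\mu$ be a probability measure on $[0,1]$, let $f:[0,1]\to(0,\infty)$ be measurable with $\lambda:=\mathbb E[f(W)]<\infty$, where $W$ is a random variable with distribution $\mu$, and let $w_0\in[0,1]$. Consider the following growing random trees $(\mathcal K_n)_{n\ge 0}$ (weighted random recursive trees), viewed as one-dimensional simplicial complexes. The initial complex $\mathcal K_0$ is the single vertex $0$, which has weight $W_0=w_0$. Given $\mathcal K_n$, which has the vertices $0,1,\dots,n$ with weights $W_0,\dots,W_n$, and given the whole past, a vertex $v$ of $\mathcal K_n$ is selected with probability $$\frac{f(W_v)}{\sum_{j=0}^n f(W_j)},$$ and $\mathcal K_{n+1}$ arises from $\mathcal K_n$ by adding a new vertex $n+1$ and the edge $\{v,n+1\}$, all existing faces being kept. The weight $W_{n+1}$ of the new vertex has distribution $\mu$ and is independent of all the weights and selections made before, the selection of $v$ included. For $k\ge 0$ let $N_k(n)$ be the number of vertices of $\mathcal K_n$ of degree $1+k$. Then, for every $k\ge 0$, $$\frac{N_k(n)}{n}\;\longrightarrow\;\mathbb E\left[\frac{\lambda f(W)^k}{(f(W)+\lambda)^{k+1}}\right]\qquad\text{in probability, as } n\to\infty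 .$$ -/

import Mathlib

open MeasureTheory ProbabilityTheory Filter Topology

noncomputable section

namespace WeightedTree

/-! Finite abstract simplicial complexes with vertices labelled by natural numbers are represented
by their finite families of faces. The empty set counts as a face. -/

/-- The `s`-faces of `K`: the members of `K` of cardinality `s + 1`. -/
def faces (K : Finset (Finset ℕ)) (s : ℕ) : Finset (Finset ℕ) :=
  K.filter fun σ => σ.card = s + 1

/-- The set of labels of the vertices (`0`-faces) of `K`. -/
def vertices (K : Finset (Finset ℕ)) : Finset ℕ :=
  (faces K 0).biUnion id

/-- The degree of `v` in `K`: the number of `1`-faces of `K` that contain `v`. -/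
def degree (K : Finset (Finset ℕ)) (v : ℕ) : ℕ :=
  ((faces K 1).filter fun σ => v ∈ σ).card

/-- The vertex `m` is joined to the face `σ` of `K`, and the downward closure is taken;
all the faces of `K` are kept. -/
def subdivide (K : Finset (Finset ℕ)) (σ : Finset ℕ) (m : ℕ) : Finset (Finset ℕ) :=
  K ∪ (insert m σ).powerset

/-- The complexes that arise from the single vertex `0` when, for every `n ≥ 0`, the vertex `n + 1`
arrives in step `n + 1` and is joined to the `0`-face `{v n}`. -/
def complexSeq (v : ℕ → ℕ) : ℕ → Finset (Finset ℕ)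
  | 0 => {∅, {0}}
  | n + 1 => subdivide (complexSeq v n) {v n} (n + 1)

/-- The members of the sequence are downward closed, so they are simplicial complexes. -/
theorem isLowerSet_complexSeq (v : ℕ → ℕ) (n : ℕ) :
    IsLowerSet (complexSeq v n : Set (Finset ℕ)) := by
  induction n with
  | zero =>
    intro a b hba ha
    simp only [complexSeq, Finset.coe_insert, Finset.coe_singleton, Set.mem_insert_iff,
      Set.mem_singleton_iff] at ha ⊢
    rcases ha with rfl | rfl
    · exact Or.inl (Finset.subset_empty.mp hba)
    · exact Finset.subset_singleton_iff.mp hba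
  | succ n ih =>
    intro a b hba ha
    simp only [complexSeq, subdivide, Finset.coe_union, Set.mem_union, Finset.mem_coe,
      Finset.mem_powerset] at ha ⊢
    rcases ha with h | h
    · exact Or.inl (ih hba h)
    · exact Or.inr (hba.trans h)

/-- The number of vertices of degree `1 + k` in `K`. -/
def numDegree (K : Finset (Finset ℕ)) (k : ℕ) : ℕ :=
  ((vertices K).filter fun v => degree K v = 1 + k).card

/-- The partition function: the total fitness of the `0`-faces of `K`, where the vertex `v` has
weight `w v`. -/
def partitionFunction (f : unitInterval → ℝ) (w : ℕ → unitInterval) (K : Finset (Finset ℕ)) : ℝ :=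
  ∑ v ∈ vertices K, f (w v)

/-- The `σ`-algebra generated by the weights of the vertices `0, …, n` and by the vertices selected
in the first `n` steps. -/
abbrev history {Ω : Type*} (W : ℕ → Ω → unitInterval) (V : ℕ → Ω → ℕ) (n : ℕ) : MeasurableSpace Ω :=
  (⨆ i ≤ n, MeasurableSpace.comap (W i) inferInstance) ⊔
    ⨆ i < n, MeasurableSpace.comap (V i) inferInstance

/-- The random dynamics of Model A in dimension one, started from the single vertex `0` of weight
`w₀`, with weight distribution `μ` and fitness function `f`. Here `W n` is the weight of the
vertex `n`, and `V n` is the vertex of the complex at time `n` that is selected in step `n + 1`. -/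
structure IsProcess {Ω : Type*} [MeasurableSpace Ω] (P : Measure Ω) (μ : Measure unitInterval)
    (f : unitInterval → ℝ) (w₀ : unitInterval) (W : ℕ → Ω → unitInterval) (V : ℕ → Ω → ℕ) :
    Prop where
  measurable_weight : ∀ n, Measurable (W n)
  measurable_selected : ∀ n, Measurable (V n)
  /-- The initial vertex has weight `w₀`. -/
  weight_zero : ∀ᵐ ω ∂P, W 0 ω = w₀
  /-- Given the past, a vertex of the current complex is selected with probability proportional to
  its fitness. -/
  selection : ∀ n v : ℕ,
    P[(V n ⁻¹' {v}).indicator (fun _ => (1 : ℝ)) | history W V n] =ᵐ[P] fun ω =>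
      if v ∈ vertices (complexSeq (fun i => V i ω) n) then
        f (W v ω) /
          partitionFunction f (fun i => W i ω) (complexSeq (fun i => V i ω) n)
      else 0
  /-- Every new vertex has a weight of law `μ`. -/
  weight_law : ∀ n, P.map (W (n + 1)) = μ
  /-- The weight of the new vertex is independent of the past, the selection of the current step
  included. -/
  weight_indep : ∀ n, Indep (MeasurableSpace.comap (W (n + 1)) inferInstance)
    (history W V n ⊔ MeasurableSpace.comap (V n) inferInstance) P

end WeightedTree

end

/-! The degree of a non-root vertex is one plus the number of times it has been selected, so apart
from the root the claim concerns the empirical law of the selection counts. It is proved through the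
generating function `n⁻¹ ∑ z ^ count` for `z` in `(0, 1)`. With `c = 1 - z`, the power `z ^ count`
is the product of the factors `1 - c I` over the later steps, where `I` indicates a selection of the
vertex.

Three replacements make this average tractable. First, all weights up to time `N` are revealed in
advance. Later weights are independent of the past and of the current selection, so the selection
probabilities are unchanged (`IsProcess.condExp_selected`). Replacing each `I` by its probability
leaves deviations that are negatively correlated for distinct vertices, since one step cannot select
two vertices. Hence the sum of `N` deviations has second moment at most `N`, and its average tends
to zero in probability. Second, by the strong law, the total fitness `S i` may be replaced by `l *
i`, where `l` is the mean fitness; a Cesàro argument controls the cost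
(`tendsto_average_prod_sub_prod`). Third, each product now depends on a single weight, so a weak law
for pairwise independent variables applies. The mean is found pointwise: for fixed fitness `y`, the
sum of products satisfies an affine recursion, and its average tends to `l / (l + c * y)`.

This limit expands as a geometric series in `z`, whose coefficients are those in the theorem.
Convergence of generating functions passes to the coefficients by induction on the degree, with `z`
taken small (`tendstoInMeasure_coeff`). -/

/-! ### Deterministic estimates for recursions and products. -/

/-- A sequence with `T (n + 1) = (1 - a / n) T n + 1` for large `n` grows like `n / (1 + a)`. -/
theorem tendsto_div_of_affine_recursion {T θ : ℕ → ℝ} {a : ℝ} (ha : 0 ≤ a)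
    (hT : ∀ n, T (n + 1) = (1 - θ n) * T n + 1) (hθ : ∀ᶠ n : ℕ in atTop, θ n = a / n) :
    Tendsto (fun n : ℕ => T n / n) atTop (𝓝 (1 / (1 + a))) := by
  obtain ⟨N₀, hN₀⟩ := eventually_atTop.1 hθ
  obtain ⟨N₁, hN₁⟩ := exists_nat_ge a
  -- From `N` on, `θ n = a / n` and `n ≥ max a 1`, so the factor `1 - a / n` lies in `[0, 1]`.
  set N := max N₀ (max N₁ 1) with hN
  have ha1 : (1 + a) ≠ 0 := by positivity
  -- The sequence `n / (1 + a)` solves the recursion exactly, so the error is merely multiplied by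
  -- `1 - a / n` and cannot grow.
  have hbound : ∀ m, |T (N + m) - (N + m : ℕ) / (1 + a)| ≤ |T N - N / (1 + a)| := by
    intro m
    induction m with
    | zero => simp
    | succ m ih =>
      refine le_trans ?_ ih
      have hpos : 1 ≤ N + m := by omega
      have hge : a ≤ ((N + m : ℕ) : ℝ) := hN₁.trans (by exact_mod_cast (by omega))
      have hpos' : (0 : ℝ) < ((N + m : ℕ) : ℝ) := by exact_mod_cast hpos
      have key : T (N + (m + 1)) - ((N + (m + 1) : ℕ) : ℝ) / (1 + a)
          = (1 - a / ((N + m : ℕ) : ℝ)) * (T (N + m) - ((N + m : ℕ) : ℝ) / (1 + a)) := by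
        rw [← add_assoc, hT, hN₀ (N + m) (by omega)]
        push_cast at hpos' ⊢
        field_simp
        ring
      rw [key, abs_mul]
      have h1 : a / ((N + m : ℕ) : ℝ) ≤ 1 := (div_le_one hpos').2 hge
      have h0 : 0 ≤ a / ((N + m : ℕ) : ℝ) := by positivity
      exact mul_le_of_le_one_left (abs_nonneg _) (abs_le.2 ⟨by linarith, by linarith⟩)
  have hd : Tendsto (fun n : ℕ => (T n - n / (1 + a)) / n) atTop (𝓝 0) := by
    refine squeeze_zero_norm' (a := fun n : ℕ => |T N - N / (1 + a)| / n) ?_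
      (tendsto_const_div_atTop_nhds_zero_nat _)
    filter_upwards [eventually_ge_atTop N] with n hn
    obtain ⟨m, rfl⟩ := Nat.exists_eq_add_of_le hn
    rw [Real.norm_eq_abs, abs_div, Nat.abs_cast]
    exact div_le_div_of_nonneg_right (hbound m) (Nat.cast_nonneg _)
  have := hd.add_const (1 / (1 + a))
  rw [zero_add] at this
  refine this.congr' ?_
  filter_upwards [eventually_ge_atTop 1] with n hn
  have : (n : ℝ) ≠ 0 := by positivity
  field_simp
  ring

/-- The factors are exchanged one at a time; all the others are bounded by one. -/
theorem abs_prod_sub_prod_le {ι : Type*} (s : Finset ι) {a b : ι → ℝ}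
    (ha : ∀ i ∈ s, a i ∈ Set.Icc (0 : ℝ) 1) (hb : ∀ i ∈ s, b i ∈ Set.Icc (0 : ℝ) 1) :
    |∏ i ∈ s, a i - ∏ i ∈ s, b i| ≤ ∑ i ∈ s, |a i - b i| := by
  classical
  induction s using Finset.induction_on with
  | empty => simp
  | insert i s hi ih =>
    rw [Finset.prod_insert hi, Finset.prod_insert hi, Finset.sum_insert hi]
    have ih' := ih (fun j hj => ha j (Finset.mem_insert_of_mem hj))
      (fun j hj => hb j (Finset.mem_insert_of_mem hj))
    have hai := ha i (Finset.mem_insert_self _ _)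
    have hp0 : 0 ≤ ∏ j ∈ s, b j :=
      Finset.prod_nonneg fun j hj => (hb j (Finset.mem_insert_of_mem hj)).1
    have hp1 : ∏ j ∈ s, b j ≤ 1 :=
      Finset.prod_le_one (fun j hj => (hb j (Finset.mem_insert_of_mem hj)).1)
        fun j hj => (hb j (Finset.mem_insert_of_mem hj)).2
    calc |a i * ∏ j ∈ s, a j - b i * ∏ j ∈ s, b j|
        = |a i * (∏ j ∈ s, a j - ∏ j ∈ s, b j) + (a i - b i) * ∏ j ∈ s, b j| := by ring_nf
      _ ≤ |a i| * |∏ j ∈ s, a j - ∏ j ∈ s, b j| + |a i - b i| * |∏ j ∈ s, b j| := by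
          rw [← abs_mul, ← abs_mul]; exact abs_add_le _ _
      _ ≤ 1 * |∏ j ∈ s, a j - ∏ j ∈ s, b j| + |a i - b i| * 1 := by
          gcongr
          · rw [abs_of_nonneg hai.1]; exact hai.2
          · rw [abs_of_nonneg hp0]; exact hp1
      _ ≤ |a i - b i| + ∑ j ∈ s, |a j - b j| := by linarith

theorem one_sub_mul_div_mem_Icc {c x s : ℝ} (hc : c ∈ Set.Icc (0 : ℝ) 1) (hx : 0 ≤ x)
    (hxs : x ≤ s) : 1 - c * (x / s) ∈ Set.Icc (0 : ℝ) 1 := by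
  have h0 : 0 ≤ x / s := div_nonneg hx (hx.trans hxs)
  have h1 : x / s ≤ 1 := div_le_one_of_le₀ hxs (hx.trans hxs)
  have h2 := mul_le_one₀ hc.2 h0 h1
  have h3 := mul_nonneg hc.1 h0
  exact ⟨by linarith, by linarith⟩

theorem max_one_sub_mem_Icc {y : ℝ} (hy : 0 ≤ y) : max 0 (1 - y) ∈ Set.Icc (0 : ℝ) 1 :=
  ⟨le_max_left _ _, max_le zero_le_one (by linarith)⟩

/-- If the partial sums of `x` grow like `l n`, they may be replaced by `l n` in the averaged
products. -/
theorem tendsto_average_prod_sub_prod {x : ℕ → ℝ} (hx : ∀ n, 0 < x n) {l c : ℝ} (hl : 0 < l)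
    (hc : c ∈ Set.Icc (0 : ℝ) 1)
    (hS : Tendsto (fun n : ℕ => (∑ j ∈ Finset.range (n + 1), x j) / n) atTop (𝓝 l)) :
    Tendsto (fun n : ℕ => (n : ℝ)⁻¹ * ∑ j ∈ Finset.range n,
      (∏ i ∈ Finset.Ico (j + 1) n, (1 - c * (x (j + 1) / ∑ m ∈ Finset.range (i + 1), x m))
        - ∏ i ∈ Finset.Ico (j + 1) n, max 0 (1 - c * x (j + 1) / (l * i)))) atTop (𝓝 0) := by
  set S : ℕ → ℝ := fun n => ∑ j ∈ Finset.range (n + 1), x j with hSdef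
  have hSpos : ∀ n, 0 < S n := fun n => Finset.sum_pos (fun j _ => hx j) (by simp)
  have hu : Tendsto (fun i : ℕ => |1 - S i / i / l|) atTop (𝓝 0) := by
    have := ((hS.div_const l).const_sub 1).abs
    simpa [hl.ne'] using this
  refine squeeze_zero_norm (a := fun n : ℕ => (n : ℝ)⁻¹ * ∑ i ∈ Finset.range n,
    |1 - S i / i / l|) ?_ hu.cesaro
  intro n
  rw [Real.norm_eq_abs, abs_mul, abs_of_nonneg (by positivity : (0 : ℝ) ≤ (n : ℝ)⁻¹)]
  refine mul_le_mul_of_nonneg_left ?_ (by positivity)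
  have hle : ∀ j i, j + 1 ≤ i → x (j + 1) ≤ S i := fun j i hji =>
    Finset.single_le_sum (f := x) (fun m _ => (hx m).le) (by simp; omega)
  calc |∑ j ∈ Finset.range n,
      (∏ i ∈ Finset.Ico (j + 1) n, (1 - c * (x (j + 1) / S i))
        - ∏ i ∈ Finset.Ico (j + 1) n, max 0 (1 - c * x (j + 1) / (l * i)))|
      ≤ ∑ j ∈ Finset.range n, ∑ i ∈ Finset.Ico (j + 1) n, x (j + 1) * |1 / S i - 1 / (l * i)| := by
        refine (Finset.abs_sum_le_sum_abs _ _).trans (Finset.sum_le_sum fun j _ => ?_)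
        refine (abs_prod_sub_prod_le _ ?_ ?_).trans (Finset.sum_le_sum fun i hi => ?_)
        · intro i hi
          exact one_sub_mul_div_mem_Icc hc (hx _).le (hle j i (Finset.mem_Ico.1 hi).1)
        · intro i hi
          exact max_one_sub_mem_Icc
            (div_nonneg (mul_nonneg hc.1 (hx _).le) (mul_nonneg hl.le i.cast_nonneg))
        -- The factor with `S i` is nonnegative and equals its positive part. The factor with `l *
        -- i` may be negative for small `i`, hence the truncation, which is 1-Lipschitz.
        · have h0 := (one_sub_mul_div_mem_Icc hc (hx _).le (hle j i (Finset.mem_Ico.1 hi).1)).1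
          calc |1 - c * (x (j + 1) / S i) - max 0 (1 - c * x (j + 1) / (l * i))|
              = |max 0 (1 - c * (x (j + 1) / S i)) - max 0 (1 - c * x (j + 1) / (l * i))| := by
                rw [max_eq_right h0]
            _ ≤ |(1 - c * (x (j + 1) / S i)) - (1 - c * x (j + 1) / (l * i))| := by
                rw [max_comm, max_comm (0 : ℝ)]
                exact abs_max_sub_max_le_abs _ _ _
            _ = c * (x (j + 1) * |1 / S i - 1 / (l * i)|) := by
                have e : (1 - c * (x (j + 1) / S i)) - (1 - c * x (j + 1) / (l * i))
                    = -(c * (x (j + 1) * (1 / S i - 1 / (l * i)))) := by ring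
                rw [e, abs_neg, abs_mul, abs_mul, abs_of_nonneg hc.1, abs_of_pos (hx (j + 1))]
            _ ≤ _ := mul_le_of_le_one_left (mul_nonneg (hx _).le (abs_nonneg _)) hc.2
    -- After the exchange of sums, the weights `x (j + 1)` with `j < i` add up to at most `S i`,
    -- which cancels the denominator and leaves the relative error of `S i` against `l * i`.
    _ = ∑ i ∈ Finset.range n, ∑ j ∈ Finset.range i, x (j + 1) * |1 / S i - 1 / (l * i)| := by
        refine Finset.sum_comm' fun j i => ?_
        simp only [Finset.mem_range, Finset.mem_Ico]
        omega
    _ ≤ ∑ i ∈ Finset.range n, |1 - S i / i / l| := by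
        refine Finset.sum_le_sum fun i _ => ?_
        rw [← Finset.sum_mul]
        have h1 : ∑ j ∈ Finset.range i, x (j + 1) ≤ S i := by
          simp only [hSdef, Finset.sum_range_succ']
          linarith [hx 0]
        calc _ ≤ S i * |1 / S i - 1 / (l * i)| := by gcongr
          _ = |S i * (1 / S i - 1 / (l * i))| := by rw [abs_mul, abs_of_pos (hSpos i)]
          _ = |1 - S i / i / l| := by
            congr 1
            rw [mul_sub, mul_one_div_cancel (hSpos i).ne', div_div, mul_comm l, mul_one_div]
          _ ≤ _ := le_rfl

/-! ### Convergence in measure and extraction of coefficients. -/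

section ConvergenceInMeasure

variable {α : Type*} {mα : MeasurableSpace α} {ν : Measure α}

theorem tendstoInMeasure_of_norm_le {E : Type*} [SeminormedAddCommGroup E] {f h : ℕ → α → E}
    {g k : α → E} {C : ℝ}
    (hf : TendstoInMeasure ν f atTop g) (hC : 0 < C)
    (hle : ∀ n, ∀ᵐ x ∂ν, ‖h n x - k x‖ ≤ C * ‖f n x - g x‖) :
    TendstoInMeasure ν h atTop k := by
  rw [tendstoInMeasure_iff_norm] at hf ⊢
  intro ε hε
  refine tendsto_of_tendsto_of_tendsto_of_le_of_le tendsto_const_nhds (hf (ε / C) (by positivity))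
    (fun n => zero_le) fun n => measure_mono_ae ?_
  filter_upwards [hle n] with x hx (hx' : ε ≤ _)
  show ε / C ≤ _
  rw [div_le_iff₀ hC, mul_comm]
  exact hx'.trans hx

theorem tendstoInMeasure_add_real {f f' : ℕ → α → ℝ} {g g' : α → ℝ}
    (hf : TendstoInMeasure ν f atTop g) (hf' : TendstoInMeasure ν f' atTop g') :
    TendstoInMeasure ν (fun n x => f n x + f' n x) atTop (fun x => g x + g' x) := by
  rw [tendstoInMeasure_iff_norm] at hf hf' ⊢
  intro ε hε
  have hsum := (hf (ε / 2) (by positivity)).add (hf' (ε / 2) (by positivity))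
  rw [add_zero] at hsum
  refine tendsto_of_tendsto_of_tendsto_of_le_of_le tendsto_const_nhds hsum
    (fun n => zero_le) fun n => (measure_mono ?_).trans (measure_union_le _ _)
  intro x (hx : ε ≤ _)
  by_contra hcon
  simp only [Set.mem_union, Set.mem_ofPred_eq, not_or, not_le] at hcon
  have := norm_add_le (f n x - g x) (f' n x - g' x)
  rw [show f n x + f' n x - (g x + g' x) = f n x - g x + (f' n x - g' x) by ring] at hx
  linarith [hcon.1, hcon.2]

theorem tendstoInMeasure_const_mul_real {f : ℕ → α → ℝ} {g : α → ℝ}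
    (hf : TendstoInMeasure ν f atTop g) (c : ℝ) :
    TendstoInMeasure ν (fun n x => c * f n x) atTop (fun x => c * g x) := by
  refine tendstoInMeasure_of_norm_le hf (by positivity : 0 < |c| + 1) fun n => .of_forall fun x => ?_
  rw [← mul_sub, norm_mul, Real.norm_eq_abs c]
  gcongr
  linarith

theorem tendstoInMeasure_sum_real {ι : Type*} (s : Finset ι) {f : ι → ℕ → α → ℝ} {g : ι → α → ℝ}
    (hf : ∀ i ∈ s, TendstoInMeasure ν (f i) atTop (g i)) :
    TendstoInMeasure ν (fun n x => ∑ i ∈ s, f i n x) atTop (fun x => ∑ i ∈ s, g i x) := by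
  classical
  induction s using Finset.induction_on with
  | empty =>
    intro ε hε
    simp [hε.ne']
  | insert i s hi ih =>
    simp only [Finset.sum_insert hi]
    exact tendstoInMeasure_add_real (hf i (Finset.mem_insert_self _ _))
      (ih fun j hj => hf j (Finset.mem_insert_of_mem hj))

/-- Convergence in measure of generating functions implies convergence in measure of their
coefficients. -/
theorem tendstoInMeasure_coeff {G : ℝ → ℕ → α → ℝ} {g : ℝ → ℝ} {Q : ℕ → ℕ → α → ℝ} {q : ℕ → ℝ}
    (hG : ∀ z ∈ Set.Ioo (0 : ℝ) 1, TendstoInMeasure ν (G z) atTop (fun _ => g z))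
    (hQ : ∀ z ∈ Set.Ioo (0 : ℝ) 1, ∀ k n x,
      G z n x - ∑ j ∈ Finset.range (k + 1), z ^ j * Q j n x ∈ Set.Icc 0 (z ^ (k + 1)))
    (hq : ∀ z ∈ Set.Ioo (0 : ℝ) 1, ∀ k,
      g z - ∑ j ∈ Finset.range (k + 1), z ^ j * q j ∈ Set.Icc 0 (z ^ (k + 1))) (k : ℕ) :
    TendstoInMeasure ν (Q k) atTop (fun _ => q k) := by
  induction k using Nat.strong_induction_on with
  | _ k ih =>
    have hR : ∀ z ∈ Set.Ioo (0 : ℝ) 1,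
        TendstoInMeasure ν (fun n x => G z n x + -1 * ∑ j ∈ Finset.range k, z ^ j * Q j n x) atTop
          (fun _ => g z + -1 * ∑ j ∈ Finset.range k, z ^ j * q j) := fun z hz =>
      tendstoInMeasure_add_real (hG z hz) (tendstoInMeasure_const_mul_real
        (tendstoInMeasure_sum_real _ fun j hj =>
          tendstoInMeasure_const_mul_real (ih j (Finset.mem_range.1 hj)) _) _)
    rw [tendstoInMeasure_iff_norm]
    intro ε hε
    -- With `z < ε / 2`, the tail `z ^ (k + 1)` takes at most half of `z ^ k * ε`, the scale at
    -- which the `k`-th coefficient is seen.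
    obtain ⟨z, hz0, hz⟩ := exists_between (lt_min (half_pos hε) one_pos)
    rw [lt_min_iff] at hz
    have hzm : z ∈ Set.Ioo (0 : ℝ) 1 := ⟨hz0, hz.2⟩
    have hlim := tendstoInMeasure_iff_norm.1 (hR z hzm) (z ^ k * (ε / 2)) (by positivity)
    refine tendsto_of_tendsto_of_tendsto_of_le_of_le tendsto_const_nhds hlim
      (fun n => zero_le) fun n => measure_mono ?_
    intro x (hx : ε ≤ ‖Q k n x - q k‖)
    have h1 := hQ z hzm k n x
    have h2 := hq z hzm k
    rw [Finset.sum_range_succ] at h1 h2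
    set A := ∑ j ∈ Finset.range k, z ^ j * Q j n x
    set B := ∑ j ∈ Finset.range k, z ^ j * q j
    have hzk : 0 < z ^ k := by positivity
    have h3 : z ^ (k + 1) ≤ z ^ k * (ε / 2) := by
      rw [pow_succ]; exact mul_le_mul_of_nonneg_left hz.1.le hzk.le
    have h4 : z ^ k * ε ≤ |z ^ k * (Q k n x - q k)| := by
      rw [abs_mul, abs_of_pos hzk]; exact mul_le_mul_of_nonneg_left hx hzk.le
    have h5 : |z ^ k * (Q k n x - q k)| ≤ |G z n x + -1 * A - (g z + -1 * B)| + z ^ (k + 1) := by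
      have e : z ^ k * (Q k n x - q k) = (G z n x + -1 * A - (g z + -1 * B))
        + ((g z - (B + z ^ k * q k)) - (G z n x - (A + z ^ k * Q k n x))) := by ring
      rw [e]
      -- Both tails lie in `[0, z ^ (k + 1)]`, so their difference costs `z ^ (k + 1)` only once.
      refine (abs_add_le _ _).trans (add_le_add le_rfl ?_)
      exact abs_le.2 ⟨by linarith [h1.2, h2.1], by linarith [h1.1, h2.2]⟩
    change z ^ k * (ε / 2) ≤ |_|
    linarith

/-- Chebyshev's inequality, that is, Markov's inequality for the squares. -/
theorem tendstoInMeasure_zero_of_integral_sq_le [IsFiniteMeasure ν] {X : ℕ → α → ℝ}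
    (hX : ∀ n, MemLp (X n) 2 ν) {u : ℕ → ℝ} (hu : Tendsto u atTop (𝓝 0))
    (hle : ∀ n, ∫ x, X n x ^ 2 ∂ν ≤ u n) :
    TendstoInMeasure ν X atTop (fun _ => 0) := by
  rw [tendstoInMeasure_iff_norm]
  intro ε hε
  have h1 : Tendsto (fun n => ENNReal.ofReal (u n / ε ^ 2)) atTop (𝓝 0) := by
    have := ENNReal.tendsto_ofReal (hu.div_const (ε ^ 2))
    simpa using this
  refine tendsto_of_tendsto_of_tendsto_of_le_of_le tendsto_const_nhds h1
    (fun n => zero_le) fun n => ?_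
  have hset : {x | ε ≤ ‖X n x - 0‖} = {x | ε ^ 2 ≤ X n x ^ 2} := by
    ext x
    simp only [sub_zero, Real.norm_eq_abs, Set.mem_ofPred_eq]
    rw [sq_le_sq, abs_of_pos hε]
  have hm := mul_meas_ge_le_integral_of_nonneg (.of_forall fun x => sq_nonneg (X n x))
    (hX n).integrable_sq (ε ^ 2)
  show ν {x | ε ≤ ‖X n x - 0‖} ≤ _
  rw [hset, ← ENNReal.ofReal_toReal (measure_ne_top ν {x | ε ^ 2 ≤ X n x ^ 2})]
  refine ENNReal.ofReal_le_ofReal ?_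
  rw [le_div_iff₀ (by positivity), mul_comm]
  exact hm.trans (hle n)

end ConvergenceInMeasure

/-! ### Conditional expectations and bounded measurable functions. -/

section ConditionalExpectation

variable {Ω : Type*} {m₁ m₁' m₂ m : MeasurableSpace Ω} {P : Measure Ω}

/-- Adding an independent `σ`-algebra does not change a conditional expectation. -/
theorem condExp_sup_of_indep [IsProbabilityMeasure P] (h₁ : m₁ ≤ m₁') (h₁' : m₁' ≤ m) (h₂ : m₂ ≤ m)
    (hindep : Indep m₂ m₁' P) {g : Ω → ℝ} (hgm : StronglyMeasurable[m₁'] g)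
    (hg : Integrable g P) : P[g | m₁ ⊔ m₂] =ᵐ[P] P[g | m₁] := by
  have hsup : m₁ ⊔ m₂ ≤ m := sup_le (h₁.trans h₁') h₂
  -- Independence factorises integrals over the rectangles `A ∩ B`. Used for both `g` and `P[g |
  -- m₁]`, this identifies them on a π-system generating `m₁ ⊔ m₂`.
  have key : ∀ (A B : Set Ω), MeasurableSet[m₁'] A → MeasurableSet[m₂] B → ∀ h : Ω → ℝ,
      StronglyMeasurable[m₁'] h → Integrable h P →
      ∫ x in A ∩ B, h x ∂P = P.real B * ∫ x in A, h x ∂P := by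
    intro A B hA hB h hh hhi
    have hAh : StronglyMeasurable[m₁'] (A.indicator h) := hh.indicator hA
    have e := setIntegral_condExp (μ := P) h₂ (hhi.indicator (h₁' _ hA)) hB
    rw [Set.inter_comm, ← setIntegral_indicator (h₁' _ hA), ← e,
      setIntegral_congr_ae (g := fun _ => P[A.indicator h]) (h₂ _ hB)
        ((condExp_indep_eq h₁' h₂ hAh hindep.symm).mono fun x hx _ => hx),
      setIntegral_const, smul_eq_mul, integral_indicator (h₁' _ hA)]
  symm
  refine ae_eq_condExp_of_forall_setIntegral_eq hsup hg
    (fun _ _ _ => integrable_condExp.integrableOn) ?_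
    (StronglyMeasurable.aestronglyMeasurable
      (stronglyMeasurable_condExp.mono (le_sup_left : m₁ ≤ m₁ ⊔ m₂)))
  intro s hs _
  let 𝒮 : Set (Set Ω) := {s | ∃ A B, MeasurableSet[m₁] A ∧ MeasurableSet[m₂] B ∧ s = A ∩ B}
  have h𝒮 : IsPiSystem 𝒮 := by
    rintro _ ⟨A, B, hA, hB, rfl⟩ _ ⟨A', B', hA', hB', rfl⟩ -
    exact ⟨A ∩ A', B ∩ B', hA.inter hA', hB.inter hB', Set.inter_inter_inter_comm _ _ _ _⟩
  have hgen : m₁ ⊔ m₂ = MeasurableSpace.generateFrom 𝒮 := by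
    refine le_antisymm (sup_le ?_ ?_) (MeasurableSpace.generateFrom_le ?_)
    · intro A hA
      exact MeasurableSpace.measurableSet_generateFrom ⟨A, Set.univ, hA, .univ, by simp⟩
    · intro B hB
      exact MeasurableSpace.measurableSet_generateFrom ⟨Set.univ, B, .univ, hB, by simp⟩
    · rintro _ ⟨A, B, hA, hB, rfl⟩
      exact MeasurableSet.inter ((le_sup_left : m₁ ≤ m₁ ⊔ m₂) _ hA)
        ((le_sup_right : m₂ ≤ m₁ ⊔ m₂) _ hB)
  have hci : Integrable (P[g | m₁]) P := integrable_condExp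
  refine MeasurableSpace.induction_on_inter
    (C := fun s _ => ∫ x in s, (P[g | m₁]) x ∂P = ∫ x in s, g x ∂P)
    hgen h𝒮 (by simp) ?_ ?_ ?_ s hs
  · rintro _ ⟨A, B, hA, hB, rfl⟩
    rw [key A B (h₁ _ hA) hB _ (stronglyMeasurable_condExp.mono h₁) hci,
      key A B (h₁ _ hA) hB _ hgm hg, setIntegral_condExp (h₁.trans h₁') hg hA]
  · intro t ht ih
    rw [setIntegral_compl (hsup _ ht) hci, setIntegral_compl (hsup _ ht) hg, ih,
      integral_condExp (h₁.trans h₁')]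
  · intro t hd ht ih
    rw [integral_iUnion (fun i => hsup _ (ht i)) hd hci.integrableOn,
      integral_iUnion (fun i => hsup _ (ht i)) hd hg.integrableOn]
    exact tsum_congr ih

/-- Bounded functions that are measurable with respect to a given `σ`-algebra. -/
def BoundedMeasurable (m : MeasurableSpace Ω) (Z : Ω → ℝ) : Prop :=
  StronglyMeasurable[m] Z ∧ ∃ C, ∀ ω, ‖Z ω‖ ≤ C

namespace BoundedMeasurable

variable {Z Z' : Ω → ℝ}

theorem mono (hZ : BoundedMeasurable m₁ Z) (h : m₁ ≤ m₂) : BoundedMeasurable m₂ Z :=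
  ⟨hZ.1.mono h, hZ.2⟩

theorem const (c : ℝ) : BoundedMeasurable m fun _ : Ω => c :=
  ⟨stronglyMeasurable_const, ‖c‖, fun _ => le_rfl⟩

theorem add (hZ : BoundedMeasurable m Z) (hZ' : BoundedMeasurable m Z') :
    BoundedMeasurable m fun ω => Z ω + Z' ω := by
  obtain ⟨C, hC⟩ := hZ.2
  obtain ⟨C', hC'⟩ := hZ'.2
  exact ⟨hZ.1.add hZ'.1, C + C', fun ω => (norm_add_le _ _).trans (add_le_add (hC ω) (hC' ω))⟩

theorem mul (hZ : BoundedMeasurable m Z) (hZ' : BoundedMeasurable m Z') :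
    BoundedMeasurable m fun ω => Z ω * Z' ω := by
  obtain ⟨C, hC⟩ := hZ.2
  obtain ⟨C', hC'⟩ := hZ'.2
  refine ⟨hZ.1.mul hZ'.1, C * C', fun ω => (norm_mul_le _ _).trans ?_⟩
  exact mul_le_mul (hC ω) (hC' ω) (norm_nonneg _) ((norm_nonneg _).trans (hC ω))

theorem sub (hZ : BoundedMeasurable m Z) (hZ' : BoundedMeasurable m Z') :
    BoundedMeasurable m fun ω => Z ω - Z' ω := by
  have := hZ.add ((const (-1)).mul hZ')
  simpa [sub_eq_add_neg] using this

theorem prod {ι : Type*} (s : Finset ι) {F : ι → Ω → ℝ}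
    (hF : ∀ i ∈ s, BoundedMeasurable m (F i)) : BoundedMeasurable m fun ω => ∏ i ∈ s, F i ω := by
  classical
  induction s using Finset.induction_on with
  | empty => simpa using const 1
  | insert i s hi ih =>
    simp only [Finset.prod_insert hi]
    exact (hF i (Finset.mem_insert_self _ _)).mul
      (ih fun j hj => hF j (Finset.mem_insert_of_mem hj))

theorem sum {ι : Type*} (s : Finset ι) {F : ι → Ω → ℝ}
    (hF : ∀ i ∈ s, BoundedMeasurable m (F i)) : BoundedMeasurable m fun ω => ∑ i ∈ s, F i ω := by
  classical
  induction s using Finset.induction_on with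
  | empty => simpa using const 0
  | insert i s hi ih =>
    simp only [Finset.sum_insert hi]
    exact (hF i (Finset.mem_insert_self _ _)).add
      (ih fun j hj => hF j (Finset.mem_insert_of_mem hj))

theorem memLp [IsFiniteMeasure P] (hZ : BoundedMeasurable m₁ Z) (h₁ : m₁ ≤ m) (p : ENNReal) :
    MemLp Z p P := by
  obtain ⟨C, hC⟩ := hZ.2
  exact MemLp.of_bound (hZ.1.mono h₁).aestronglyMeasurable C (.of_forall hC)

theorem integrable [IsFiniteMeasure P] (hZ : BoundedMeasurable m₁ Z) (h₁ : m₁ ≤ m) :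
    Integrable Z P :=
  memLp_one_iff_integrable.1 (hZ.memLp h₁ 1)

/-- The known factor is pulled out of the conditional expectation. This is how the selection
probabilities enter the covariance computation. -/
theorem integral_mul_eq [IsFiniteMeasure P] (hZ : BoundedMeasurable m₁ Z) (h₁ : m₁ ≤ m)
    {g p : Ω → ℝ} (hg : Integrable g P) (hp : P[g | m₁] =ᵐ[P] p) :
    ∫ ω, Z ω * g ω ∂P = ∫ ω, Z ω * p ω ∂P := by
  obtain ⟨C, hC⟩ := hZ.2
  rw [← integral_condExp (μ := P) (f := fun ω => Z ω * g ω) h₁]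
  refine integral_congr_ae ?_
  filter_upwards [condExp_stronglyMeasurable_mul_of_bound h₁ hZ.1 hg C (.of_forall hC), hp]
    with ω h1 h2
  rw [Pi.mul_apply, h2] at h1
  exact h1

end BoundedMeasurable

end ConditionalExpectation

/-! ### Negative correlation of the thinned products. -/

section Covariance

variable {Ω : Type*} {m : MeasurableSpace Ω} {P : Measure Ω} [IsProbabilityMeasure P]

/-- The product of the factors `1 - c Z i` over `v ≤ i < n`. -/
def thinning {Ω : Type*} (c : ℝ) (Z : ℕ → ℕ → Ω → ℝ) (n v : ℕ) (ω : Ω) : ℝ :=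
  ∏ i ∈ Finset.Ico v n, (1 - c * Z i v ω)

theorem thinning_succ (c : ℝ) (Z : ℕ → ℕ → Ω → ℝ) {n v : ℕ} (h : v ≤ n) (ω : Ω) :
    thinning c Z (n + 1) v ω = thinning c Z n v ω * (1 - c * Z n v ω) :=
  Finset.prod_Ico_succ_top h _

theorem thinning_self (c : ℝ) (Z : ℕ → ℕ → Ω → ℝ) (v : ℕ) (ω : Ω) :
    thinning c Z v v ω = 1 := by
  simp [thinning]

theorem one_sub_mul_mem_Icc {c y : ℝ} (hc : c ∈ Set.Icc (0 : ℝ) 1) (hy : y ∈ Set.Icc (0 : ℝ) 1) :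
    1 - c * y ∈ Set.Icc (0 : ℝ) 1 := by
  have h2 := mul_le_one₀ hc.2 hy.1 hy.2
  have h3 := mul_nonneg hc.1 hy.1
  exact ⟨by linarith, by linarith⟩

theorem thinning_mem_Icc {c : ℝ} (hc : c ∈ Set.Icc (0 : ℝ) 1) {Z : ℕ → ℕ → Ω → ℝ} {v : ℕ}
    (hZ : ∀ i, v ≤ i → ∀ ω, Z i v ω ∈ Set.Icc (0 : ℝ) 1) (n : ℕ) (ω : Ω) :
    thinning c Z n v ω ∈ Set.Icc (0 : ℝ) 1 := by
  have h : ∀ i ∈ Finset.Ico v n, 1 - c * Z i v ω ∈ Set.Icc (0 : ℝ) 1 := fun i hi =>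
    one_sub_mul_mem_Icc hc (hZ i (Finset.mem_Ico.1 hi).1 ω)
  exact ⟨Finset.prod_nonneg fun i hi => (h i hi).1,
    Finset.prod_le_one (fun i hi => (h i hi).1) fun i hi => (h i hi).2⟩

variable {𝒢 : ℕ → MeasurableSpace Ω} {I p : ℕ → ℕ → Ω → ℝ} {c : ℝ} {N : ℕ}

theorem boundedMeasurable_thinning {m₁ : MeasurableSpace Ω} {Z : ℕ → ℕ → Ω → ℝ} {n v : ℕ}
    (hZ : ∀ i, v ≤ i → i < n → BoundedMeasurable m₁ (Z i v)) :
    BoundedMeasurable m₁ (thinning c Z n v) :=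
  BoundedMeasurable.prod _ fun i hi => (BoundedMeasurable.const 1).sub
    ((BoundedMeasurable.const c).mul (hZ i (Finset.mem_Ico.1 hi).1 (Finset.mem_Ico.1 hi).2))

/-- Given conditional selection probabilities `p` that are known at time `0`, the deviations of the
thinned products at distinct vertices are negatively correlated. -/
theorem integral_mul_thinning_sub_mul_thinning_sub_nonpos (h𝒢 : Monotone 𝒢)
    (hle : ∀ n, 𝒢 n ≤ m) (hc : c ∈ Set.Icc (0 : ℝ) 1)
    (hI : ∀ i v, BoundedMeasurable (𝒢 (i + 1)) (I i v))
    (hI01 : ∀ i v ω, I i v ω ∈ Set.Icc (0 : ℝ) 1)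
    (hdisj : ∀ i u v ω, u ≠ v → I i u ω * I i v ω = 0)
    (hp : ∀ i < N, ∀ v ≤ i, BoundedMeasurable (𝒢 0) (p i v))
    (hp01 : ∀ i, ∀ v ≤ i, ∀ ω, p i v ω ∈ Set.Icc (0 : ℝ) 1)
    (hcond : ∀ i < N, ∀ v ≤ i, P[I i v | 𝒢 i] =ᵐ[P] p i v) {u v : ℕ} (huv : u < v) {n : ℕ}
    (hvn : v ≤ n) (hnN : n ≤ N) {Y : Ω → ℝ} (hY : BoundedMeasurable (𝒢 0) Y)
    (hY0 : ∀ ω, 0 ≤ Y ω) :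
    ∫ ω, Y ω * ((thinning c I n u ω - thinning c p n u ω)
      * (thinning c I n v ω - thinning c p n v ω)) ∂P ≤ 0 := by
  -- The induction starts at the younger vertex `v`, whose products are still empty. The weight `Y`
  -- is left general so that it can absorb the factors of each step.
  induction n, hvn using Nat.le_induction generalizing Y with
  | base => simp [thinning_self]
  | succ n hvn ih =>
    have hn : n < N := hnN
    have hun : u ≤ n := huv.le.trans hvn
    have hXm : ∀ w, BoundedMeasurable (𝒢 n) (thinning c I n w) := fun w =>
      boundedMeasurable_thinning fun i _ hi => (hI i w).mono (h𝒢 hi)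
    have ham : ∀ w, BoundedMeasurable (𝒢 0) (thinning c p n w) := fun w =>
      boundedMeasurable_thinning fun i hw hi => hp i (hi.trans hn) w hw
    have hpu := hp n hn u hun
    have hpv := hp n hn v hvn
    have h0 := h𝒢 (Nat.zero_le n)
    have hone : BoundedMeasurable (𝒢 0) (fun _ => (1 : ℝ)) := BoundedMeasurable.const 1
    have hcm : BoundedMeasurable (𝒢 0) (fun _ => c) := BoundedMeasurable.const c
    have hqu := hone.sub (hcm.mul hpu)
    have hqv := hone.sub (hcm.mul hpv)
    have hau := (ham u).mul hqu
    have hav := (ham v).mul hqv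
    have hα := (hY.mono h0).mul (((hXm u).sub (hau.mono h0)).mul ((hXm v).sub (hav.mono h0)))
    have hβ := (hY.mono h0).mul ((hcm.mono h0).mul ((hXm u).mul ((hXm v).sub (hav.mono h0))))
    have hγ := (hY.mono h0).mul ((hcm.mono h0).mul ((hXm v).mul ((hXm u).sub (hau.mono h0))))
    have hIu := (hI n u).integrable (P := P) (hle _)
    have hIv := (hI n v).integrable (P := P) (hle _)
    have eu := hβ.integral_mul_eq (hle n) hIu (hcond n hn u hun)
    have ev := hγ.integral_mul_eq (hle n) hIv (hcond n hn v hvn)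
    have iα := hα.integrable (P := P) (hle n)
    have iβ := ((hβ.mono (h𝒢 n.le_succ)).mul (hI n u)).integrable (P := P) (hle _)
    have iγ := ((hγ.mono (h𝒢 n.le_succ)).mul (hI n v)).integrable (P := P) (hle _)
    have iβ' := (hβ.mul (hpu.mono h0)).integrable (P := P) (hle _)
    have iγ' := (hγ.mul (hpv.mono h0)).integrable (P := P) (hle _)
    have hY' := hY.mul (hqu.mul hqv)
    have ie := ((hY'.mono h0).mul (((hXm u).sub ((ham u).mono h0)).mul
      ((hXm v).sub ((ham v).mono h0)))).integrable (P := P) (hle _)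
    have hqu0 : ∀ ω, 1 - c * p n u ω ∈ Set.Icc (0 : ℝ) 1 := fun ω =>
      one_sub_mul_mem_Icc hc (hp01 n u hun ω)
    have hqv0 : ∀ ω, 1 - c * p n v ω ∈ Set.Icc (0 : ℝ) 1 := fun ω =>
      one_sub_mul_mem_Icc hc (hp01 n v hvn ω)
    -- The new weight is `Y * (1 - c * p n u) * (1 - c * p n v)`, still nonnegative and known at
    -- time `0`.
    refine le_trans ?_ (ih hn.le hY'
      fun ω => mul_nonneg (hY0 ω) (mul_nonneg (hqu0 ω).1 (hqv0 ω).1))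
    have hexp : ∀ ω, Y ω * ((thinning c I (n + 1) u ω - thinning c p (n + 1) u ω)
        * (thinning c I (n + 1) v ω - thinning c p (n + 1) v ω))
        = Y ω * ((thinning c I n u ω - thinning c p n u ω * (1 - c * p n u ω))
            * (thinning c I n v ω - thinning c p n v ω * (1 - c * p n v ω)))
          - Y ω * (c * (thinning c I n u ω
            * (thinning c I n v ω - thinning c p n v ω * (1 - c * p n v ω)))) * I n u ω
          - Y ω * (c * (thinning c I n v ω
            * (thinning c I n u ω - thinning c p n u ω * (1 - c * p n u ω)))) * I n v ω := by
      intro ω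
      rw [thinning_succ c I hun, thinning_succ c I hvn, thinning_succ c p hun,
        thinning_succ c p hvn]
      -- The quadratic term in the two indicators vanishes, as `u` and `v` are not both selected.
      linear_combination (Y ω * c ^ 2 * thinning c I n u ω * thinning c I n v ω)
        * hdisj n u v ω huv.ne
    have hsub : ∀ {A B C : Ω → ℝ}, Integrable A P → Integrable B P → Integrable C P →
        ∫ ω, A ω - B ω - C ω ∂P = ∫ ω, A ω ∂P - ∫ ω, B ω ∂P - ∫ ω, C ω ∂P :=
      fun hA hB hC => (integral_sub (hA.sub hB) hC).trans (by rw [← integral_sub hA hB]; rfl)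
    rw [integral_congr_ae (.of_forall hexp), hsub iα iβ iγ, eu, ev, ← hsub iα iβ' iγ']
    refine integral_mono ((iα.sub iβ').sub iγ') ie fun ω => ?_
    -- This is exactly the gap: independent selections would contribute this product of
    -- probabilities, whereas exclusive ones contribute zero.
    have hrest : 0 ≤ Y ω * ((c * p n u ω) * (c * p n v ω)
        * (thinning c I n u ω * thinning c I n v ω)) := by
      have h1 := (thinning_mem_Icc hc (v := u) (fun i _ => hI01 i u) n ω).1
      have h2 := (thinning_mem_Icc hc (v := v) (fun i _ => hI01 i v) n ω).1
      have h3 := (hp01 n u hun ω).1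
      have h4 := (hp01 n v hvn ω).1
      have h5 := hc.1
      have h6 := hY0 ω
      positivity
    beta_reduce
    linarith

/-- The second moment of the sum of the deviations is at most the number of summands. -/
theorem integral_sq_sum_thinning_sub_le (h𝒢 : Monotone 𝒢)
    (hle : ∀ n, 𝒢 n ≤ m) (hc : c ∈ Set.Icc (0 : ℝ) 1)
    (hI : ∀ i v, BoundedMeasurable (𝒢 (i + 1)) (I i v))
    (hI01 : ∀ i v ω, I i v ω ∈ Set.Icc (0 : ℝ) 1)
    (hdisj : ∀ i u v ω, u ≠ v → I i u ω * I i v ω = 0)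
    (hp : ∀ i < N, ∀ v ≤ i, BoundedMeasurable (𝒢 0) (p i v))
    (hp01 : ∀ i, ∀ v ≤ i, ∀ ω, p i v ω ∈ Set.Icc (0 : ℝ) 1)
    (hcond : ∀ i < N, ∀ v ≤ i, P[I i v | 𝒢 i] =ᵐ[P] p i v) :
    ∫ ω, (∑ j ∈ Finset.range N,
      (thinning c I N (j + 1) ω - thinning c p N (j + 1) ω)) ^ 2 ∂P ≤ N := by
  have hm : ∀ w, BoundedMeasurable (𝒢 N) fun ω => thinning c I N w ω - thinning c p N w ω :=
    fun w => (boundedMeasurable_thinning fun i _ hi => (hI i w).mono (h𝒢 hi)).sub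
      ((boundedMeasurable_thinning fun i hw hi => hp i hi w hw).mono (h𝒢 N.zero_le))
  have hoff : ∀ u v, u < v → v ≤ N → ∫ ω, (thinning c I N u ω - thinning c p N u ω)
      * (thinning c I N v ω - thinning c p N v ω) ∂P ≤ 0 := by
    intro u v huv hv
    have := integral_mul_thinning_sub_mul_thinning_sub_nonpos h𝒢 hle hc hI hI01 hdisj hp hp01
      hcond huv hv le_rfl (BoundedMeasurable.const 1) fun _ => zero_le_one
    simpa using this
  have hsq : ∀ ω, (∑ j ∈ Finset.range N,
      (thinning c I N (j + 1) ω - thinning c p N (j + 1) ω)) ^ 2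
      = ∑ j ∈ Finset.range N, ∑ k ∈ Finset.range N,
        (thinning c I N (j + 1) ω - thinning c p N (j + 1) ω)
          * (thinning c I N (k + 1) ω - thinning c p N (k + 1) ω) := fun ω => by
    rw [sq, Finset.sum_mul_sum]
  rw [integral_congr_ae (.of_forall hsq), integral_finsetSum _ fun j _ =>
    integrable_finsetSum _ fun k _ => ((hm (j + 1)).mul (hm (k + 1))).integrable (hle N)]
  calc _ = ∑ j ∈ Finset.range N, ∑ k ∈ Finset.range N,
        ∫ ω, (thinning c I N (j + 1) ω - thinning c p N (j + 1) ω)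
          * (thinning c I N (k + 1) ω - thinning c p N (k + 1) ω) ∂P :=
        Finset.sum_congr rfl fun j _ => integral_finsetSum _ fun k _ =>
          ((hm (j + 1)).mul (hm (k + 1))).integrable (hle N)
    -- Off-diagonal terms are nonpositive; each diagonal term is the square of a difference of two
    -- numbers in `[0, 1]`.
    _ ≤ ∑ j ∈ Finset.range N, ∑ k ∈ Finset.range N, if j = k then (1 : ℝ) else 0 := by
        refine Finset.sum_le_sum fun j hj => Finset.sum_le_sum fun k hk => ?_
        rw [Finset.mem_range] at hj hk
        rcases lt_trichotomy j k with h | rfl | h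
        · rw [if_neg h.ne]
          exact hoff _ _ (by omega) (by omega)
        · rw [if_pos rfl]
          have hb : ∀ ω, (thinning c I N (j + 1) ω - thinning c p N (j + 1) ω)
              * (thinning c I N (j + 1) ω - thinning c p N (j + 1) ω) ≤ 1 := fun ω => by
            have h1 := thinning_mem_Icc hc (v := j + 1) (fun i _ => hI01 i (j + 1)) N ω
            have h2 := thinning_mem_Icc hc (v := j + 1) (fun i hi => hp01 i (j + 1) hi) N ω
            rw [← sq, sq_le_one_iff_abs_le_one, abs_le]
            exact ⟨by linarith [h1.1, h2.2], by linarith [h1.2, h2.1]⟩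
          have := integral_mono (((hm (j + 1)).mul (hm (j + 1))).integrable (P := P) (hle N))
            (integrable_const (1 : ℝ)) hb
          simpa using this
        · rw [if_neg h.ne']
          refine le_trans (le_of_eq ?_) (hoff _ _ (Nat.succ_lt_succ h) (by omega))
          exact integral_congr_ae (.of_forall fun ω => mul_comm _ _)
    _ = N := by
        rw [Finset.sum_congr rfl fun j hj =>
          (Finset.sum_ite_eq (Finset.range N) j fun _ => (1 : ℝ)).trans (if_pos hj)]
        simp

end Covariance

/-! ### A weak law for triangular arrays of functions. -/

section LawOfLargeNumbers

variable {Ω β : Type*} {m : MeasurableSpace Ω} {P : Measure Ω} [IsProbabilityMeasure P]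
  [MeasurableSpace β] {ρ : Measure β}

/-- A weak law of large numbers for averages of bounded functions, depending on the position, of
pairwise independent variables with a common law. -/
theorem tendstoInMeasure_average {X : ℕ → Ω → β} (hX : ∀ j, Measurable (X j))
    (hlaw : ∀ j, P.map (X j) = ρ) (hindep : Pairwise fun i j => IndepFun (X i) (X j) P)
    {φ : ℕ → ℕ → β → ℝ} (hφ : ∀ n j, Measurable (φ n j))
    (hφ01 : ∀ n j x, φ n j x ∈ Set.Icc (0 : ℝ) 1) {L : ℝ}
    (hL : Tendsto (fun n : ℕ => ∫ x, (n : ℝ)⁻¹ * ∑ j ∈ Finset.range n, φ n j x ∂ρ) atTop (𝓝 L)) :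
    TendstoInMeasure P (fun (n : ℕ) ω => (n : ℝ)⁻¹ * ∑ j ∈ Finset.range n, φ n j (X j ω)) atTop
      (fun _ => L) := by
  have hρ : IsProbabilityMeasure ρ := hlaw 0 ▸ Measure.isProbabilityMeasure_map (hX 0).aemeasurable
  have hmem : ∀ n j, MemLp (fun ω => φ n j (X j ω)) 2 P := fun n j =>
    MemLp.of_bound ((hφ n j).comp (hX j)).aestronglyMeasurable 1 (.of_forall fun ω => by
      rw [Real.norm_eq_abs, abs_le]
      exact ⟨by linarith [(hφ01 n j (X j ω)).1], (hφ01 n j (X j ω)).2⟩)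
  have hφint : ∀ n j, Integrable (φ n j) ρ := fun n j =>
    Integrable.of_bound (hφ n j).aestronglyMeasurable 1 (.of_forall fun x => by
      rw [Real.norm_eq_abs, abs_le]
      exact ⟨by linarith [(hφ01 n j x).1], (hφ01 n j x).2⟩)
  set B : ℕ → Ω → ℝ := fun n ω => (n : ℝ)⁻¹ * ∑ j ∈ Finset.range n, φ n j (X j ω) with hB
  have hBmem : ∀ n, MemLp (B n) 2 P := fun n =>
    (memLp_finsetSum (p := 2) (Finset.range n) fun j _ => hmem n j).const_mul _
  have hmean : ∀ n, ∫ ω, B n ω ∂P = ∫ x, (n : ℝ)⁻¹ * ∑ j ∈ Finset.range n, φ n j x ∂ρ := by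
    intro n
    rw [integral_const_mul, integral_const_mul, integral_finsetSum _ fun j _ =>
      (hmem n j).integrable one_le_two, integral_finsetSum _ fun j _ => hφint n j]
    congr 1
    refine Finset.sum_congr rfl fun j _ => ?_
    rw [← hlaw j, integral_map (hX j).aemeasurable (hφ n j).aestronglyMeasurable]
  -- Under pairwise independence the variances add: `n` terms, each at most one, scaled by `n⁻¹ ^
  -- 2`.
  have hvar : ∀ n, ∫ ω, (B n ω - ∫ ω, B n ω ∂P) ^ 2 ∂P ≤ 1 / (n : ℝ) := by
    intro n
    rw [← variance_eq_integral (hBmem n).aemeasurable]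
    have hsum : B n = fun ω => (n : ℝ)⁻¹ * (∑ j ∈ Finset.range n, fun ω => φ n j (X j ω)) ω := by
      ext ω
      simp [hB]
    rw [hsum, variance_const_mul, IndepFun.variance_sum (fun j _ => hmem n j)
      fun i _ j _ hij => (hindep hij).comp (hφ n i) (hφ n j)]
    have h1 : ∀ j, variance (fun ω => φ n j (X j ω)) P ≤ 1 := by
      intro j
      refine (variance_le_expectation_sq (hmem n j).aestronglyMeasurable).trans ?_
      have := integral_mono (hmem n j).integrable_sq (integrable_const (1 : ℝ))
        (fun ω => pow_le_one₀ (n := 2) (hφ01 n j (X j ω)).1 (hφ01 n j (X j ω)).2)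
      simpa using this
    have h2 : ∑ j ∈ Finset.range n, variance (fun ω => φ n j (X j ω)) P ≤ n := by
      simpa using Finset.sum_le_card_nsmul (Finset.range n) _ 1 fun j _ => h1 j
    rcases n.eq_zero_or_pos with rfl | hn
    · simp
    · have : (0 : ℝ) < n := by exact_mod_cast hn
      calc _ ≤ ((n : ℝ)⁻¹) ^ 2 * n := by gcongr
        _ = 1 / n := by field_simp
  have hcent := tendstoInMeasure_zero_of_integral_sq_le
    (fun n => (hBmem n).sub (memLp_const (∫ ω, B n ω ∂P))) tendsto_one_div_atTop_nhds_zero_nat hvar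
  have hdet : TendstoInMeasure P (fun (n : ℕ) (_ : Ω) => ∫ ω, B n ω ∂P) atTop (fun _ => L) :=
    tendstoInMeasure_of_tendsto_ae (fun n => aestronglyMeasurable_const)
      (.of_forall fun _ => by simpa only [hmean] using hL)
  have := tendstoInMeasure_add_real hcent hdet
  simpa using this

end LawOfLargeNumbers

/-! ### Combinatorics of the tree: degrees as selection counts. -/

namespace WeightedTree

section Combinatorics

variable {v : ℕ → ℕ}

theorem mem_complexSeq_iff (v : ℕ → ℕ) (n : ℕ) (σ : Finset ℕ) :
    σ ∈ complexSeq v n ↔ σ ⊆ {0} ∨ ∃ i < n, σ ⊆ {i + 1, v i} := by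
  induction n with
  | zero => simp [complexSeq, Finset.subset_singleton_iff]
  | succ n ih =>
    simp only [complexSeq, subdivide, Finset.mem_union, Finset.mem_powerset, ih, or_assoc,
      Nat.exists_lt_succ_right]

theorem vertices_complexSeq {n : ℕ} (hv : ∀ i < n, v i ≤ i) :
    vertices (complexSeq v n) = Finset.range (n + 1) := by
  ext w
  have : w ∈ vertices (complexSeq v n) ↔ {w} ∈ complexSeq v n := by
    simp only [vertices, faces, Finset.mem_biUnion, Finset.mem_filter, zero_add, id]
    constructor
    · rintro ⟨σ, ⟨hσ, hc⟩, hw⟩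
      obtain ⟨a, rfl⟩ := Finset.card_eq_one.1 hc
      rwa [Finset.mem_singleton.1 hw]
    · intro h
      exact ⟨{w}, ⟨h, Finset.card_singleton _⟩, Finset.mem_singleton_self _⟩
  rw [this, mem_complexSeq_iff]
  simp only [Finset.singleton_subset_iff, Finset.mem_singleton, Finset.mem_insert,
    Finset.mem_range]
  constructor
  · rintro (rfl | ⟨i, hi, rfl | rfl⟩)
    · omega
    · omega
    · have := hv i hi
      omega
  · intro hw
    rcases w with _ | w
    · exact Or.inl rfl
    · exact Or.inr ⟨w, by omega, Or.inl rfl⟩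

theorem faces_one_complexSeq {n : ℕ} (hv : ∀ i < n, v i ≤ i) :
    faces (complexSeq v n) 1 = (Finset.range n).image fun i => {i + 1, v i} := by
  have hcard : ∀ i < n, ({i + 1, v i} : Finset ℕ).card = 2 := fun i hi =>
    Finset.card_pair (by have := hv i hi; omega)
  ext σ
  simp only [faces, Finset.mem_filter, mem_complexSeq_iff, Finset.mem_image, Finset.mem_range]
  constructor
  · rintro ⟨h | ⟨i, hi, h⟩, hc⟩
    · have := Finset.card_le_card h
      rw [Finset.card_singleton] at this
      omega
    · exact ⟨i, hi, (Finset.eq_of_subset_of_card_le h (by rw [hcard i hi, hc])).symm⟩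
  · rintro ⟨i, hi, rfl⟩
    exact ⟨Or.inr ⟨i, hi, subset_rfl⟩, hcard i hi⟩

/-- The number of the steps up to `n` in which the vertex `w` is selected after its arrival. -/
def selectionCount (v : ℕ → ℕ) (n w : ℕ) : ℕ :=
  ((Finset.Ico w n).filter fun i => v i = w).card

/-- The summand `1` is the edge with which the vertex `j + 1` arrives, in step `j + 1`; every other
edge at it comes from a later selection. -/
theorem degree_complexSeq {n j : ℕ} (hv : ∀ i < n, v i ≤ i) (hj : j < n) :
    degree (complexSeq v n) (j + 1) = 1 + selectionCount v n (j + 1) := by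
  rw [degree, faces_one_complexSeq hv, Finset.filter_image, Finset.card_image_of_injOn]
  · have : (Finset.range n).filter (fun i => j + 1 ∈ ({i + 1, v i} : Finset ℕ))
        = insert j ((Finset.Ico (j + 1) n).filter fun i => v i = j + 1) := by
      ext i
      simp only [Finset.mem_filter, Finset.mem_range, Finset.mem_insert, Finset.mem_singleton,
        Finset.mem_Ico]
      constructor
      · rintro ⟨hi, h⟩
        have := hv i hi
        omega
      · rintro (rfl | h)
        · exact ⟨hj, Or.inl rfl⟩
        · omega
    rw [this, Finset.card_insert_of_notMem (by simp), selectionCount, add_comm]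
  -- An edge determines its step, because `i + 1` is its larger endpoint.
  · intro a ha b hb hab
    simp only [Finset.coe_filter, Finset.mem_range, Set.mem_ofPred_eq] at ha hb
    beta_reduce at hab
    have h1 : a + 1 ∈ ({b + 1, v b} : Finset ℕ) := by rw [← hab]; simp
    have h2 : b + 1 ∈ ({a + 1, v a} : Finset ℕ) := by rw [hab]; simp
    have h3 := hv a ha.1
    have h4 := hv b hb.1
    simp only [Finset.mem_insert, Finset.mem_singleton] at h1 h2
    omega

/-- Up to the contribution of the root, the number of vertices of degree `1 + k` is the number of
vertices that have been selected `k` times. -/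
theorem abs_numDegree_complexSeq_sub_le {n : ℕ} (hv : ∀ i < n, v i ≤ i) (k : ℕ) :
    |(numDegree (complexSeq v n) k : ℝ)
      - ∑ j ∈ Finset.range n, if selectionCount v n (j + 1) = k then (1 : ℝ) else 0| ≤ 1 := by
  -- The root is split off: it has no arrival edge, so its degree does not fit the formula, and it
  -- accounts for the error of at most one.
  rw [numDegree, vertices_complexSeq hv, Finset.card_filter, Finset.sum_range_succ']
  push_cast
  have : ∀ j ∈ Finset.range n,
      (if degree (complexSeq v n) (j + 1) = 1 + k then (1 : ℝ) else 0)
        = if selectionCount v n (j + 1) = k then (1 : ℝ) else 0 := fun j hj => by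
    rw [degree_complexSeq hv (Finset.mem_range.1 hj)]
    simp only [Nat.add_left_cancel_iff]
  rw [Finset.sum_congr rfl this, add_sub_cancel_left]
  split_ifs <;> simp

end Combinatorics

/-! ### Selection probabilities and total fitness. -/

section SelectionDynamics

variable {Ω : Type*} {m : MeasurableSpace Ω} {P : Measure Ω}
  {μ : Measure unitInterval} {f : unitInterval → ℝ} {w₀ : unitInterval}
  {W : ℕ → Ω → unitInterval} {V : ℕ → Ω → ℕ}

/-- If the earlier selections are admissible, the current vertices are `0, …, n`. Any other label
then has conditional probability zero, and there are only countably many labels. -/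
theorem IsProcess.ae_selected_le [IsProbabilityMeasure P]
    (h : IsProcess P μ f w₀ W V) : ∀ᵐ ω ∂P, ∀ n, V n ω ≤ n := by
  rw [ae_all_iff]
  intro n
  induction n using Nat.strong_induction_on with
  | _ n ih =>
    have hpast : ∀ᵐ ω ∂P, ∀ i < n, V i ω ≤ i := by
      rw [ae_all_iff]
      intro i
      by_cases hi : i < n
      · filter_upwards [ih i hi] with ω hω _ using hω
      · exact .of_forall fun ω hi' => absurd hi' hi
    have hne : ∀ᵐ ω ∂P, ∀ w, n < w → V n ω ≠ w := by
      rw [ae_all_iff]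
      intro w
      by_cases hw : n < w
      swap
      · exact .of_forall fun ω hw' => absurd hw' hw
      have hms : MeasurableSet (V n ⁻¹' {w}) := h.measurable_selected n (measurableSet_singleton w)
      have hle : history W V n ≤ m := sup_le
        (iSup₂_le fun i _ => (h.measurable_weight i).comap_le)
        (iSup₂_le fun i _ => (h.measurable_selected i).comap_le)
      have hzero : P[(V n ⁻¹' {w}).indicator (fun _ => (1 : ℝ)) | history W V n] =ᵐ[P] 0 := by
        filter_upwards [h.selection n w, hpast] with ω hω hp
        rw [hω, if_neg, Pi.zero_apply]
        rw [vertices_complexSeq hp, Finset.mem_range]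
        omega
      have hint := integral_condExp (μ := P) (f := (V n ⁻¹' {w}).indicator (fun _ => (1 : ℝ))) hle
      rw [integral_congr_ae hzero, integral_indicator hms, setIntegral_const] at hint
      have hP : P (V n ⁻¹' {w}) = 0 := by
        simpa [measureReal_def, ENNReal.toReal_eq_zero_iff] using hint.symm
      filter_upwards [measure_eq_zero_iff_ae_notMem.1 hP] with ω hω _ using hω
    filter_upwards [hne] with ω hω
    by_contra hcon
    exact hω _ (not_le.1 hcon) rfl

/-- The share of the vertex `v` in the total fitness of the vertices `0, …, i`. -/
noncomputable def share {Ω : Type*} (f : unitInterval → ℝ) (W : ℕ → Ω → unitInterval) (i v : ℕ) (ω : Ω) : ℝ :=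
  f (W v ω) / ∑ j ∈ Finset.range (i + 1), f (W j ω)

/-- The indicator of the selection of the vertex `v` in step `i + 1`. -/
noncomputable def selected {Ω : Type*} (V : ℕ → Ω → ℕ) (i v : ℕ) : Ω → ℝ :=
  (V i ⁻¹' {v}).indicator fun _ => (1 : ℝ)

/-- The `σ`-algebra generated by the weights of the vertices `0, …, N` and by the vertices selected
in the first `n` steps. -/
abbrev weightsHistory {Ω : Type*} (W : ℕ → Ω → unitInterval) (V : ℕ → Ω → ℕ) (N n : ℕ) :
    MeasurableSpace Ω :=
  (⨆ i ≤ N, MeasurableSpace.comap (W i) inferInstance) ⊔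
    ⨆ i < n, MeasurableSpace.comap (V i) inferInstance

theorem weightsHistory_mono {Ω : Type*} (W : ℕ → Ω → unitInterval) (V : ℕ → Ω → ℕ) (N : ℕ) :
    Monotone (weightsHistory W V N) := fun _ _ hab =>
  sup_le_sup le_rfl (biSup_mono fun _ hi => lt_of_lt_of_le hi hab)

theorem IsProcess.weightsHistory_le (h : IsProcess P μ f w₀ W V) (N n : ℕ) :
    weightsHistory W V N n ≤ m :=
  sup_le (iSup₂_le fun i _ => (h.measurable_weight i).comap_le)
    (iSup₂_le fun i _ => (h.measurable_selected i).comap_le)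

theorem comap_weight_le_weightsHistory {Ω : Type*} (W : ℕ → Ω → unitInterval) (V : ℕ → Ω → ℕ)
    {N i : ℕ} (n : ℕ) (hi : i ≤ N) :
    MeasurableSpace.comap (W i) inferInstance ≤ weightsHistory W V N n :=
  le_sup_of_le_left (le_iSup₂ (f := fun i (_ : i ≤ N) =>
    MeasurableSpace.comap (W i) inferInstance) i hi)

theorem comap_selected_le_weightsHistory {Ω : Type*} (W : ℕ → Ω → unitInterval) (V : ℕ → Ω → ℕ)
    (N : ℕ) {n i : ℕ} (hi : i < n) :
    MeasurableSpace.comap (V i) inferInstance ≤ weightsHistory W V N n :=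
  le_sup_of_le_right (le_iSup₂ (f := fun i (_ : i < n) =>
    MeasurableSpace.comap (V i) inferInstance) i hi)

theorem weightsHistory_succ {Ω : Type*} (W : ℕ → Ω → unitInterval) (V : ℕ → Ω → ℕ) (N n : ℕ) :
    weightsHistory W V (N + 1) n
      = weightsHistory W V N n ⊔ MeasurableSpace.comap (W (N + 1)) inferInstance := by
  refine le_antisymm (sup_le (iSup₂_le fun i hi => ?_) (iSup₂_le fun i hi => ?_))
    (sup_le (sup_le (iSup₂_le fun i hi => ?_) (iSup₂_le fun i hi => ?_)) ?_)
  · rcases Nat.le_succ_iff.1 hi with hi' | rfl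
    · exact le_sup_of_le_left (comap_weight_le_weightsHistory W V n hi')
    · exact le_sup_right
  · exact le_sup_of_le_left (comap_selected_le_weightsHistory W V N hi)
  · exact comap_weight_le_weightsHistory W V n (hi.trans N.le_succ)
  · exact comap_selected_le_weightsHistory W V _ hi
  · exact comap_weight_le_weightsHistory W V n le_rfl

theorem boundedMeasurable_selected {m₁ : MeasurableSpace Ω} {i : ℕ} (v : ℕ)
    (h : MeasurableSpace.comap (V i) inferInstance ≤ m₁) :
    BoundedMeasurable m₁ (selected V i v) := by
  refine ⟨stronglyMeasurable_const.indicator (h _ ⟨{v}, measurableSet_singleton v, rfl⟩), 1,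
    fun ω => ?_⟩
  refine (norm_indicator_le_norm_self _ _).trans ?_
  simp

theorem selected_mem_Icc (V : ℕ → Ω → ℕ) (i v : ℕ) (ω : Ω) :
    selected V i v ω ∈ Set.Icc (0 : ℝ) 1 := by
  unfold selected Set.indicator
  split_ifs <;> simp

/-- The conditional selection probabilities do not change when later weights are revealed. -/
theorem IsProcess.condExp_selected [IsProbabilityMeasure P]
    (h : IsProcess P μ f w₀ W V) {N n v : ℕ} (hn : n ≤ N)
    (hv : v ≤ n) : P[selected V n v | weightsHistory W V N n] =ᵐ[P] share f W n v := by
  have hint : Integrable (selected V n v) P :=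
    (boundedMeasurable_selected v le_rfl).integrable (h.measurable_selected n).comap_le
  induction N, hn using Nat.le_induction with
  | base =>
    refine (h.selection n v).trans ?_
    filter_upwards [h.ae_selected_le] with ω hω
    rw [partitionFunction, vertices_complexSeq fun i _ => hω i,
      if_pos (Finset.mem_range.2 (Nat.lt_succ_of_le hv)), share]
  | succ N hnN ih =>
    refine EventuallyEq.trans ?_ ih
    rw [weightsHistory_succ]
    refine condExp_sup_of_indep (m₁' := history W V N ⊔ MeasurableSpace.comap (V N) inferInstance)
      (le_sup_of_le_left (weightsHistory_mono W V N hnN))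
      (sup_le (h.weightsHistory_le N N) (h.measurable_selected N).comap_le)
      (h.measurable_weight _).comap_le (h.weight_indep N) ?_ hint
    refine (boundedMeasurable_selected v ?_).1
    -- For `N = n` the selection is not yet in the history. This is where the independence of the
    -- new weight from the current selection is needed.
    rcases hnN.lt_or_eq with hlt | rfl
    · exact le_sup_of_le_left (comap_selected_le_weightsHistory W V N hlt)
    · exact le_sup_right

theorem IsProcess.pairwise_indepFun (h : IsProcess P μ f w₀ W V) :
    Pairwise fun i j => IndepFun (W (i + 1)) (W (j + 1)) P := by
  have key : ∀ i j, i < j → IndepFun (W (j + 1)) (W (i + 1)) P := fun i j hij =>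
    (indep_of_indep_of_le_right (h.weight_indep j)
      (le_sup_of_le_left (comap_weight_le_weightsHistory W V j hij)))
  intro i j hij
  rcases hij.lt_or_gt with h' | h'
  · exact (key i j h').symm
  · exact key j i h'

theorem sum_fitness_pos (hf : ∀ x, 0 < f x) (i : ℕ) (ω : Ω) :
    0 < ∑ j ∈ Finset.range (i + 1), f (W j ω) :=
  Finset.sum_pos (fun _ _ => hf _) (by simp)

theorem share_mem_Icc (hf : ∀ x, 0 < f x) {i v : ℕ} (hv : v ≤ i) (ω : Ω) :
    share f W i v ω ∈ Set.Icc (0 : ℝ) 1 :=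
  ⟨div_nonneg (hf _).le (sum_fitness_pos hf i ω).le, div_le_one_of_le₀
    (Finset.single_le_sum (f := fun j => f (W j ω)) (fun _ _ => (hf _).le)
      (Finset.mem_range.2 (Nat.lt_succ_of_le hv))) (sum_fitness_pos hf i ω).le⟩

theorem boundedMeasurable_share (hf : ∀ x, 0 < f x) (hfm : Measurable f) {N i v : ℕ}
    (hi : i ≤ N) (hv : v ≤ i) (n : ℕ) :
    BoundedMeasurable (weightsHistory W V N n) (share f W i v) := by
  have hW : ∀ j ≤ N, Measurable[weightsHistory W V N n] fun ω => f (W j ω) := fun j hj =>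
    hfm.comp (Measurable.of_comap_le (comap_weight_le_weightsHistory W V n hj))
  refine ⟨Measurable.stronglyMeasurable ?_, 1, fun ω => ?_⟩
  · exact (hW v (hv.trans hi)).div (Finset.measurable_fun_sum _ fun j hj =>
      hW j ((Nat.lt_succ_iff.1 (Finset.mem_range.1 hj)).trans hi))
  · have := share_mem_Icc (W := W) hf hv ω
    rw [Real.norm_eq_abs, abs_of_nonneg this.1]
    exact this.2

/-- The law of large numbers for the total fitness. -/
theorem IsProcess.tendsto_sum_fitness (h : IsProcess P μ f w₀ W V) (hfm : Measurable f)
    (hfi : Integrable f μ) :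
    ∀ᵐ ω ∂P, Tendsto (fun n : ℕ => (∑ j ∈ Finset.range (n + 1), f (W j ω)) / n) atTop
      (𝓝 (∫ x, f x ∂μ)) := by
  have hlaw : ∀ i, ∫ ω, f (W (i + 1) ω) ∂P = ∫ x, f x ∂μ := fun i => by
    rw [← h.weight_law i, integral_map (h.measurable_weight _).aemeasurable
      hfm.aestronglyMeasurable]
  have hint : Integrable (fun ω => f (W 1 ω)) P := by
    rw [← h.weight_law 0] at hfi
    exact hfi.comp_measurable (h.measurable_weight 1)
  have hident : ∀ i, IdentDistrib (fun ω => f (W (i + 1) ω)) (fun ω => f (W 1 ω)) P P := fun i =>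
    IdentDistrib.comp ⟨(h.measurable_weight _).aemeasurable, (h.measurable_weight _).aemeasurable,
      (h.weight_law i).trans (h.weight_law 0).symm⟩ hfm
  filter_upwards [strong_law_ae_real (fun i ω => f (W (i + 1) ω)) hint
    (fun i j hij => (h.pairwise_indepFun hij).comp hfm hfm) hident] with ω hω
  rw [hlaw 0] at hω
  -- The initial weight need not have law `μ`; its contribution `f (W 0 ω) / n` vanishes in the
  -- limit.
  have := hω.add (tendsto_const_div_atTop_nhds_zero_nat (f (W 0 ω)))
  rw [add_zero] at this
  refine this.congr fun n => ?_
  rw [Finset.sum_range_succ', add_div]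

end SelectionDynamics

end WeightedTree

/-! ### The limit law and its generating function. -/

namespace WeightedTree

section LimitLaw

variable {μ : Measure unitInterval} [IsProbabilityMeasure μ] {f : unitInterval → ℝ}

theorem integral_fitness_pos (hf : ∀ x, 0 < f x) (hfi : Integrable f μ) : 0 < ∫ x, f x ∂μ := by
  rw [integral_pos_iff_support_of_nonneg (fun x => (hf x).le) hfi]
  have : Function.support f = Set.univ := Set.eq_univ_of_forall fun x => (hf x).ne'
  simp [this]

/-- The difference between a geometric generating function and its Taylor polynomial. -/
theorem generatingFunction_sub_sum_mem_Icc {y l z : ℝ} (hy : 0 < y) (hl : 0 < l)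
    (hz : z ∈ Set.Ioo (0 : ℝ) 1) (k : ℕ) :
    l / (l + (1 - z) * y) - ∑ j ∈ Finset.range (k + 1), z ^ j * (l * y ^ j / (y + l) ^ (j + 1))
      ∈ Set.Icc 0 (z ^ (k + 1)) := by
  have hz0 := hz.1
  have hz1 := hz.2
  have hden : 0 < l + (1 - z) * y := by nlinarith
  -- A geometric series with ratio `z * y / (y + l)`: the remainder after `j` terms is the full sum
  -- times the `j`-th power of the ratio.
  have hq : ∀ j, l / (l + (1 - z) * y)
      - ∑ i ∈ Finset.range j, z ^ i * (l * y ^ i / (y + l) ^ (i + 1))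
      = l / (l + (1 - z) * y) * (z ^ j * (y / (y + l)) ^ j) := by
    intro j
    induction j with
    | zero => simp
    | succ j ih =>
      rw [Finset.sum_range_succ, ← sub_sub, ih, div_pow, div_pow]
      field_simp
      ring
  rw [hq]
  have h1 : l / (l + (1 - z) * y) ≤ 1 := div_le_one_of_le₀ (by nlinarith) hden.le
  have h2 : (y / (y + l)) ^ (k + 1) ≤ 1 :=
    pow_le_one₀ (by positivity) (div_le_one_of_le₀ (by linarith) (by positivity))
  refine ⟨by positivity, ?_⟩
  calc l / (l + (1 - z) * y) * (z ^ (k + 1) * (y / (y + l)) ^ (k + 1))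
      ≤ 1 * (z ^ (k + 1) * 1) := by gcongr
    _ = z ^ (k + 1) := by ring

theorem integrable_of_mem_Icc {g : unitInterval → ℝ} (hg : Measurable g)
    (h : ∀ x, g x ∈ Set.Icc (0 : ℝ) 1) : Integrable g μ :=
  Integrable.of_bound hg.aestronglyMeasurable 1 (.of_forall fun x => by
    rw [Real.norm_eq_abs, abs_of_nonneg (h x).1]
    exact (h x).2)

theorem limitLaw_mem_Icc {y l : ℝ} (hy : 0 < y) (hl : 0 < l) (k : ℕ) :
    l * y ^ k / (y + l) ^ (k + 1) ∈ Set.Icc (0 : ℝ) 1 := by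
  refine ⟨by positivity, div_le_one_of_le₀ ?_ (by positivity)⟩
  rw [pow_succ, mul_comm]
  gcongr <;> linarith

theorem generatingFunction_integral_sub_sum_mem_Icc (hf : ∀ x, 0 < f x) (hfm : Measurable f)
    {l z : ℝ} (hl : 0 < l) (hz : z ∈ Set.Ioo (0 : ℝ) 1) (k : ℕ) :
    ∫ x, l / (l + (1 - z) * f x) ∂μ
      - ∑ j ∈ Finset.range (k + 1), z ^ j * ∫ x, l * f x ^ j / (f x + l) ^ (j + 1) ∂μ
      ∈ Set.Icc 0 (z ^ (k + 1)) := by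
  have i1 : Integrable (fun x => l / (l + (1 - z) * f x)) μ :=
    integrable_of_mem_Icc (by fun_prop) fun x => by
      have := mul_pos (sub_pos.2 hz.2) (hf x)
      exact ⟨by positivity, div_le_one_of_le₀ (by linarith) (by positivity)⟩
  have i2 : ∀ j : ℕ, Integrable (fun x => z ^ j * (l * f x ^ j / (f x + l) ^ (j + 1))) μ :=
    fun j => (integrable_of_mem_Icc (by fun_prop) fun x => limitLaw_mem_Icc (hf x) hl j).const_mul _
  have e : ∫ x, l / (l + (1 - z) * f x) ∂μ
      - ∑ j ∈ Finset.range (k + 1), z ^ j * ∫ x, l * f x ^ j / (f x + l) ^ (j + 1) ∂μ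
      = ∫ x, (l / (l + (1 - z) * f x)
        - ∑ j ∈ Finset.range (k + 1), z ^ j * (l * f x ^ j / (f x + l) ^ (j + 1))) ∂μ := by
    rw [integral_sub i1 (integrable_finsetSum _ fun j _ => i2 j),
      integral_finsetSum _ fun j _ => i2 j]
    simp only [integral_const_mul]
  rw [e]
  refine ⟨integral_nonneg fun x => (generatingFunction_sub_sum_mem_Icc (hf x) hl hz k).1, ?_⟩
  have := integral_mono (i1.sub (integrable_finsetSum _ fun j _ => i2 j))
    (integrable_const (z ^ (k + 1)))
    fun x => (generatingFunction_sub_sum_mem_Icc (hf x) hl hz k).2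
  simpa using this

/-- The mean of the averaged products converges. -/
theorem tendsto_integral_average_prod (hf : ∀ x, 0 < f x) (hfm : Measurable f) {l c : ℝ}
    (hl : 0 < l) (hc : c ∈ Set.Icc (0 : ℝ) 1) :
    Tendsto (fun n : ℕ => ∫ x, (n : ℝ)⁻¹ * ∑ j ∈ Finset.range n,
      ∏ i ∈ Finset.Ico (j + 1) n, max 0 (1 - c * f x / (l * i)) ∂μ) atTop
      (𝓝 (∫ x, l / (l + c * f x) ∂μ)) := by
  have h01 : ∀ x (n j : ℕ), ∏ i ∈ Finset.Ico (j + 1) n, max 0 (1 - c * f x / (l * i))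
      ∈ Set.Icc (0 : ℝ) 1 := fun x n j => by
    have h : ∀ i : ℕ, max 0 (1 - c * f x / (l * i)) ∈ Set.Icc (0 : ℝ) 1 := fun i =>
      max_one_sub_mem_Icc (div_nonneg (mul_nonneg hc.1 (hf x).le) (mul_nonneg hl.le i.cast_nonneg))
    exact ⟨Finset.prod_nonneg fun i _ => (h i).1,
      Finset.prod_le_one (fun i _ => (h i).1) fun i _ => (h i).2⟩
  refine tendsto_integral_of_dominated_convergence (fun _ => (1 : ℝ)) ?_ (integrable_const _) ?_ ?_
  · intro n
    exact Measurable.aestronglyMeasurable (by fun_prop)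
  · intro n
    refine .of_forall fun x => ?_
    have h0 := Finset.sum_nonneg fun j (_ : j ∈ Finset.range n) => (h01 x n j).1
    rw [Real.norm_eq_abs, abs_of_nonneg (mul_nonneg (by positivity) h0)]
    have h1 : ∑ j ∈ Finset.range n,
        ∏ i ∈ Finset.Ico (j + 1) n, max 0 (1 - c * f x / (l * i)) ≤ (n : ℝ) := by
      simpa using Finset.sum_le_card_nsmul (Finset.range n) _ 1 fun j _ => (h01 x n j).2
    exact (mul_le_mul_of_nonneg_left h1 (by positivity)).trans inv_mul_le_one
  · refine .of_forall fun x => ?_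
    -- Passing from `n` to `n + 1` multiplies every product by the factor at `n` and adds one empty
    -- product. This is the affine recursion with `a = c * f x / l`, once `n` is so large that the
    -- truncation is inactive.
    have ha : 0 ≤ c * f x / l := div_nonneg (mul_nonneg hc.1 (hf x).le) hl.le
    have hrec := tendsto_div_of_affine_recursion
      (T := fun n => ∑ j ∈ Finset.range n,
        ∏ i ∈ Finset.Ico (j + 1) n, max 0 (1 - c * f x / (l * i)))
      (θ := fun n : ℕ => 1 - max 0 (1 - c * f x / (l * n))) ha ?_ ?_
    · have e : l / (l + c * f x) = 1 / (1 + c * f x / l) := by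
        have := mul_nonneg hc.1 (hf x).le
        field_simp
      rw [e]
      refine hrec.congr fun n => ?_
      rw [div_eq_inv_mul]
    · intro n
      rw [Finset.sum_range_succ, Finset.Ico_self, Finset.prod_empty, Finset.mul_sum]
      congr 1
      refine Finset.sum_congr rfl fun j hj => ?_
      rw [Finset.prod_Ico_succ_top (Finset.mem_range.1 hj)]
      ring
    · obtain ⟨M, hM⟩ := exists_nat_ge (c * f x / l)
      filter_upwards [eventually_ge_atTop (max M 1)] with n hn
      have hn1 : (0 : ℝ) < n := by exact_mod_cast (le_max_right M 1).trans hn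
      have hnM : c * f x / l ≤ n := hM.trans (by exact_mod_cast (le_max_left M 1).trans hn)
      rw [← div_div, max_eq_right (sub_nonneg.2 ((div_le_one hn1).2 hnM)), sub_sub_cancel]

end LimitLaw

/-! ### Reduction to a measurable fitness function. -/

section Modification

variable {Ω : Type*} {m : MeasurableSpace Ω} {P : Measure Ω} {μ : Measure unitInterval}
  {f : unitInterval → ℝ} {w₀ : unitInterval} {W : ℕ → Ω → unitInterval} {V : ℕ → Ω → ℕ}

/-- The fitness function may be changed on a null set that does not contain the initial weight. -/
theorem IsProcess.congr_fitness (h : IsProcess P μ f w₀ W V) {g : unitInterval → ℝ}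
    (hfg : f =ᵐ[μ] g) (h₀ : f w₀ = g w₀) : IsProcess P μ g w₀ W V := by
  have hW : ∀ᵐ ω ∂P, ∀ i, f (W i ω) = g (W i ω) := by
    rw [ae_all_iff]
    rintro (_ | i)
    · filter_upwards [h.weight_zero] with ω hω
      rw [hω, h₀]
    · rw [← h.weight_law i] at hfg
      exact ae_of_ae_map (h.measurable_weight _).aemeasurable hfg
  refine ⟨h.measurable_weight, h.measurable_selected, h.weight_zero, fun n v => ?_, h.weight_law,
    h.weight_indep⟩
  refine (h.selection n v).trans ?_
  filter_upwards [hW] with ω hω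
  simp only [partitionFunction, hω]

/-- Integrability provides only an almost everywhere measurable version. Its value at `w₀` is
prescribed because `μ` may give no mass to `w₀`, the weight of the initial vertex. -/
theorem exists_measurable_pos_ae_eq (hf : ∀ x, 0 < f x) (hfi : Integrable f μ)
    (w₀ : unitInterval) :
    ∃ g : unitInterval → ℝ, Measurable g ∧ (∀ x, 0 < g x) ∧ f =ᵐ[μ] g ∧ f w₀ = g w₀ := by
  obtain ⟨g, hg, hfg⟩ := hfi.aestronglyMeasurable
  have hgm : Measurable g := hg.measurable
  classical
  refine ⟨fun x => if x = w₀ then f w₀ else if 0 < g x then g x else 1, ?_, ?_, ?_, by simp⟩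
  · exact Measurable.ite (measurableSet_singleton w₀) measurable_const
      (Measurable.ite (measurableSet_lt measurable_const hgm) hgm measurable_const)
  · intro x
    beta_reduce
    split_ifs with h1 h2
    · exact hf w₀
    · exact h2
    · exact one_pos
  · filter_upwards [hfg] with x hx
    split_ifs with h1 h2
    · rw [h1]
    · exact hx
    · exact absurd (hx ▸ hf x) h2

end Modification

/-! ### Convergence of the generating functions and of the degree counts. -/

section SelectionDynamics

variable {Ω : Type*} {m : MeasurableSpace Ω} {P : Measure Ω} [IsProbabilityMeasure P]
  {μ : Measure unitInterval} [IsProbabilityMeasure μ] {f : unitInterval → ℝ} {w₀ : unitInterval}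
  {W : ℕ → Ω → unitInterval} {V : ℕ → Ω → ℕ}

/-- The averaged generating function of the numbers of selections converges in probability. -/
theorem IsProcess.tendstoInMeasure_thinning (h : IsProcess P μ f w₀ W V) (hf : ∀ x, 0 < f x)
    (hfm : Measurable f) (hfi : Integrable f μ) {c : ℝ} (hc : c ∈ Set.Icc (0 : ℝ) 1) :
    TendstoInMeasure P (fun (n : ℕ) ω => (n : ℝ)⁻¹ * ∑ j ∈ Finset.range n,
      thinning c (selected V) n (j + 1) ω) atTop
      (fun _ => ∫ x, (∫ y, f y ∂μ) / ((∫ y, f y ∂μ) + c * f x) ∂μ) := by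
  set l := ∫ y, f y ∂μ with hl_def
  have hl : 0 < l := integral_fitness_pos hf hfi
  have hI : ∀ N i v, BoundedMeasurable (weightsHistory W V N (i + 1)) (selected V i v) :=
    fun N i v => boundedMeasurable_selected v (comap_selected_le_weightsHistory W V N i.lt_succ_self)
  have hp : ∀ N n i, i ≤ N → ∀ v ≤ i,
      BoundedMeasurable (weightsHistory W V N n) (share f W i v) :=
    fun N n i hi v hv => boundedMeasurable_share hf hfm hi hv n
  have hdev : ∀ N, BoundedMeasurable (weightsHistory W V N N) fun ω => (N : ℝ)⁻¹ *
      ∑ j ∈ Finset.range N, (thinning c (selected V) N (j + 1) ω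
        - thinning c (share f W) N (j + 1) ω) := fun N =>
    (BoundedMeasurable.const _).mul (BoundedMeasurable.sum _ fun j _ =>
      (boundedMeasurable_thinning fun i _ hi =>
        (hI N i _).mono (weightsHistory_mono W V N hi)).sub
      (boundedMeasurable_thinning fun i hv hi => hp N N i hi.le _ hv))
  -- For each `N` the filtration `weightsHistory W V N` is used, which knows the weights up to `N`
  -- from time `0`; the shares are therefore known at time `0`.
  have h1 := tendstoInMeasure_zero_of_integral_sq_le (ν := P)
    (fun N => (hdev N).memLp (h.weightsHistory_le N N) 2) tendsto_one_div_atTop_nhds_zero_nat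
    (fun N => by
      have hsq := integral_sq_sum_thinning_sub_le (P := P) (N := N)
        (weightsHistory_mono W V N) (h.weightsHistory_le N) hc (hI N) (selected_mem_Icc V)
        (fun i u v ω huv => by
          simp only [selected, Set.indicator, Set.mem_preimage, Set.mem_singleton_iff]
          split_ifs with h1 h2
          · exact absurd (h1.symm.trans h2) huv
          all_goals simp)
        (fun i hi v hv => hp N 0 i hi.le v hv)
        (fun i v hv ω => share_mem_Icc hf hv ω)
        (fun i hi v hv => h.condExp_selected hi.le hv)
      simp only [mul_pow]
      rw [integral_const_mul]
      rcases N.eq_zero_or_pos with rfl | hN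
      · simp
      · have : (0 : ℝ) < N := by exact_mod_cast hN
        calc _ ≤ ((N : ℝ)⁻¹) ^ 2 * N := by gcongr
          _ = 1 / N := by field_simp)
  have hWm := h.measurable_weight
  have h2 := tendstoInMeasure_of_tendsto_ae (μ := P)
    (f := fun (n : ℕ) ω => (n : ℝ)⁻¹ * ∑ j ∈ Finset.range n,
      (thinning c (share f W) n (j + 1) ω
        - ∏ i ∈ Finset.Ico (j + 1) n, max 0 (1 - c * f (W (j + 1) ω) / (l * i))))
    (g := fun _ => 0)
    (fun n => by
      unfold thinning share
      exact Measurable.aestronglyMeasurable (by fun_prop))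
    (by
      filter_upwards [h.tendsto_sum_fitness hfm hfi] with ω hω
      exact tendsto_average_prod_sub_prod (x := fun j => f (W j ω)) (fun j => hf _) hl hc hω)
  have h3 := tendstoInMeasure_average (P := P) (fun j => h.measurable_weight (j + 1)) h.weight_law
    h.pairwise_indepFun
    (φ := fun n j x => ∏ i ∈ Finset.Ico (j + 1) n, max 0 (1 - c * f x / (l * i)))
    (fun n j => by fun_prop)
    (fun n j x => by
      have hi : ∀ i : ℕ, max 0 (1 - c * f x / (l * i)) ∈ Set.Icc (0 : ℝ) 1 := fun i =>
        max_one_sub_mem_Icc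
          (div_nonneg (mul_nonneg hc.1 (hf x).le) (mul_nonneg hl.le i.cast_nonneg))
      exact ⟨Finset.prod_nonneg fun i _ => (hi i).1,
        Finset.prod_le_one (fun i _ => (hi i).1) fun i _ => (hi i).2⟩)
    (tendsto_integral_average_prod (μ := μ) hf hfm hl hc)
  -- The three replacements telescope.
  have h4 := tendstoInMeasure_add_real (tendstoInMeasure_add_real h1 h2) h3
  simpa only [← mul_add, ← Finset.sum_add_distrib, sub_add_sub_cancel, sub_add_cancel,
    zero_add] using h4

/-- Each selection of `v` contributes the factor `z`, every other step the factor `1`; so thinning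
with `c = 1 - z` yields the generating function. -/
theorem thinning_selected_eq (V : ℕ → Ω → ℕ) (z : ℝ) (n v : ℕ) (ω : Ω) :
    thinning (1 - z) (selected V) n v ω = z ^ selectionCount (fun i => V i ω) n v := by
  have : ∀ i, 1 - (1 - z) * selected V i v ω = if V i ω = v then z else 1 := fun i => by
    simp only [selected, Set.indicator, Set.mem_preimage, Set.mem_singleton_iff]
    split_ifs <;> ring
  simp only [thinning, this, selectionCount, Finset.prod_ite, Finset.prod_const, one_pow, mul_one]

/-- The sum equals `z ^ d` if `d ≤ k` and vanishes otherwise, so what remains is zero or a power of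
exponent at least `k + 1`. -/
theorem pow_sub_sum_mem_Icc {z : ℝ} (hz : z ∈ Set.Ioo (0 : ℝ) 1) (d k : ℕ) :
    z ^ d - ∑ j ∈ Finset.range (k + 1), z ^ j * (if d = j then 1 else 0)
      ∈ Set.Icc 0 (z ^ (k + 1)) := by
  have hz0 := hz.1.le
  simp only [mul_ite, mul_one, mul_zero, Finset.sum_ite_eq, Finset.mem_range]
  split_ifs with hd
  · simpa using pow_nonneg hz0 (k + 1)
  · rw [sub_zero]
    exact ⟨pow_nonneg hz0 d, pow_le_pow_of_le_one hz0 hz.2.le (not_lt.1 hd)⟩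

/-- The limit theorem for a measurable fitness function. -/
theorem IsProcess.tendstoInMeasure_numDegree (h : IsProcess P μ f w₀ W V) (hf : ∀ x, 0 < f x)
    (hfm : Measurable f) (hfi : Integrable f μ) (k : ℕ) :
    TendstoInMeasure P
      (fun (n : ℕ) ω => (numDegree (complexSeq (fun i => V i ω) n) k : ℝ) / n) atTop
      (fun _ => ∫ x, (∫ y, f y ∂μ) * f x ^ k / (f x + ∫ y, f y ∂μ) ^ (k + 1) ∂μ) := by
  have hl : 0 < ∫ y, f y ∂μ := integral_fitness_pos hf hfi
  have hcoeff := tendstoInMeasure_coeff (ν := P)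
    (G := fun z n ω => (n : ℝ)⁻¹ * ∑ j ∈ Finset.range n,
      z ^ selectionCount (fun i => V i ω) n (j + 1))
    (g := fun z => ∫ x, (∫ y, f y ∂μ) / ((∫ y, f y ∂μ) + (1 - z) * f x) ∂μ)
    (Q := fun k n ω => (n : ℝ)⁻¹ * ∑ j ∈ Finset.range n,
      if selectionCount (fun i => V i ω) n (j + 1) = k then (1 : ℝ) else 0)
    (q := fun k => ∫ x, (∫ y, f y ∂μ) * f x ^ k / (f x + ∫ y, f y ∂μ) ^ (k + 1) ∂μ)
    (fun z hz => by
      have := h.tendstoInMeasure_thinning hf hfm hfi (c := 1 - z)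
        ⟨by linarith [hz.2], by linarith [hz.1]⟩
      simpa only [thinning_selected_eq] using this)
    (fun z hz k n ω => by
      have e : (n : ℝ)⁻¹ * ∑ j ∈ Finset.range n, z ^ selectionCount (fun i => V i ω) n (j + 1)
          - ∑ d ∈ Finset.range (k + 1), z ^ d * ((n : ℝ)⁻¹ * ∑ j ∈ Finset.range n,
            if selectionCount (fun i => V i ω) n (j + 1) = d then (1 : ℝ) else 0)
          = (n : ℝ)⁻¹ * ∑ j ∈ Finset.range n,
            (z ^ selectionCount (fun i => V i ω) n (j + 1) - ∑ d ∈ Finset.range (k + 1),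
              z ^ d * if selectionCount (fun i => V i ω) n (j + 1) = d then (1 : ℝ) else 0) := by
        rw [Finset.sum_sub_distrib, mul_sub, Finset.sum_comm, Finset.mul_sum (Finset.range (k + 1))]
        congr 1
        refine Finset.sum_congr rfl fun d _ => ?_
        rw [← Finset.mul_sum]
        ring
      rw [e]
      have hterm := fun j => pow_sub_sum_mem_Icc hz (selectionCount (fun i => V i ω) n (j + 1)) k
      refine ⟨mul_nonneg (by positivity) (Finset.sum_nonneg fun j _ => (hterm j).1), ?_⟩
      have hzk : 0 ≤ z ^ (k + 1) := pow_nonneg hz.1.le _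
      calc _ ≤ (n : ℝ)⁻¹ * (n * z ^ (k + 1)) := by
            refine mul_le_mul_of_nonneg_left ?_ (by positivity)
            simpa using Finset.sum_le_card_nsmul (Finset.range n) _ (z ^ (k + 1))
              fun j _ => (hterm j).2
        _ ≤ 1 * z ^ (k + 1) := by
            rw [← mul_assoc]
            exact mul_le_mul_of_nonneg_right inv_mul_le_one hzk
        _ = _ := one_mul _)
    (fun z hz k => generatingFunction_integral_sub_sum_mem_Icc hf hfm hl hz k) k
  have hinv : TendstoInMeasure P (fun (n : ℕ) (_ : Ω) => 1 / (n : ℝ)) atTop (fun _ => 0) :=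
    tendstoInMeasure_of_tendsto_ae (fun n => aestronglyMeasurable_const)
      (.of_forall fun _ => tendsto_one_div_atTop_nhds_zero_nat)
  -- The root changes the count by at most one, hence the proportion by at most `1 / n`.
  have hroot := tendstoInMeasure_of_norm_le hinv one_pos
    (h := fun (n : ℕ) ω => (numDegree (complexSeq (fun i => V i ω) n) k : ℝ) / n
      - (n : ℝ)⁻¹ * ∑ j ∈ Finset.range n,
        if selectionCount (fun i => V i ω) n (j + 1) = k then (1 : ℝ) else 0)
    (k := fun _ => 0) fun n => by
      filter_upwards [h.ae_selected_le] with ω hω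
      have hb := abs_numDegree_complexSeq_sub_le (n := n) (fun i _ => hω i) k
      rw [div_eq_inv_mul, ← mul_sub, sub_zero, sub_zero, one_mul, norm_mul, Real.norm_eq_abs,
        Real.norm_eq_abs, Real.norm_eq_abs, abs_of_nonneg (by positivity : 0 ≤ (n : ℝ)⁻¹),
        abs_of_nonneg (by positivity : 0 ≤ 1 / (n : ℝ)), one_div]
      exact mul_le_of_le_one_right (by positivity) hb
  have := tendstoInMeasure_add_real hroot hcoeff
  simpa only [sub_add_cancel, zero_add] using this

end SelectionDynamics

end WeightedTree

theorem mainTheorem8 {Ω : Type*} [MeasurableSpace Ω] (P : Measure Ω) [IsProbabilityMeasure P]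
    (μ : Measure unitInterval) [IsProbabilityMeasure μ]
    (f : unitInterval → ℝ) (hf_pos : ∀ x, 0 < f x) (hf_int : Integrable f μ)
    (w₀ : unitInterval) (W : ℕ → Ω → unitInterval) (V : ℕ → Ω → ℕ)
    (hWV : WeightedTree.IsProcess P μ f w₀ W V) (k : ℕ) :
    TendstoInMeasure P
      (fun (n : ℕ) ω =>
        (WeightedTree.numDegree (WeightedTree.complexSeq (fun i => V i ω) n) k : ℝ) / n)
      atTop
      (fun _ => ∫ w, (∫ x, f x ∂μ) * f w ^ k / (f w + ∫ x, f x ∂μ) ^ (k + 1) ∂μ) := by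
  obtain ⟨g, hg, hg_pos, hfg, h₀⟩ := WeightedTree.exists_measurable_pos_ae_eq hf_pos hf_int w₀
  have hlim := (hWV.congr_fitness hfg h₀).tendstoInMeasure_numDegree hg_pos hg (hf_int.congr hfg) k
  have hint : ∫ x, f x ∂μ = ∫ x, g x ∂μ := integral_congr_ae hfg
  rw [hint]
  have hq : ∫ w, (∫ x, g x ∂μ) * f w ^ k / (f w + ∫ x, g x ∂μ) ^ (k + 1) ∂μ
      = ∫ w, (∫ x, g x ∂μ) * g w ^ k / (g w + ∫ x, g x ∂μ) ^ (k + 1) ∂μ :=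
    integral_congr_ae (hfg.mono fun x hx => by simp only [hx])
  rw [hq]
  exact hlim
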